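/- Let $d\ge 1$, equip $\mathbb Z^d$ with the max-norm $\|\cdot\|$, and let $\Delta$ be the nearest-neighbor lattice Laplacian, $(\Delta\psi)(x)=\sum_{y:\,|y-x|_1=1}(\psi(y)-\psi(x))$, where $|\cdot|_1$ is the $\ell^1$-norm. Let $V(x;\omega)$, $x\in\mathbb Z^d$, be independent identically distributed real random variables on a probability space $(\Omega,\mathcal F,\mathbb P)$ whose common distribution function $F_V(t)=\mathbb P\{V(0;\omega)\le t\}$ is uniformly Hölder-continuous: there are constants $C<\infty$ and $\theta>0$ such that $F_V(t+\epsilon)-F_V(t)\le C\epsilon^{\theta}$ for all $t\in\mathbb R$ and $\epsilon\in[0,1]$. For $g\in\mathbb R$ consider the Anderson Hamiltonian $H(\omega)=-\Delta+gV(x;\omega)$, and for $u\in\mathbb Z^d$ and $L\in\mathbb N$ let $H_{\mathrm B_L(u)}(\omega)$ be its restriction to the ball $\mathrm B_L(u)=\{x\in\mathbb Z^d:\|x-u\|\le L\}$ with Dirichlet boundary conditions (i.e. $\mathbf 1_{\mathrm B_L(u)}H(\omega)\mathbf 1_{\mathrm B_L(u)}$ acting on functions on $\mathrm B_L(u)$).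 For $m>0$ set $\gamma(m,L)=m(1+L^{-1/8})$. The ball $\mathrm B_L(u)$ is called $m$-localized (for given $\omega$ and $g$) if every $\ell^2$-normalized eigenfunction $\psi$ of $H_{\mathrm B_L(u)}(\omega)$ satisfies $$|\psi(x)|\,|\psi(y)|\le e^{-\gamma(m,L)\|x-y\|}\qquad\text{for all }x,y\in\mathrm B_L(u)\text{ with }\|x-y\|\ge L^{7/8},$$ and $m$-non-localized otherwise. Given an integer $L_0$, define $L_{k+1}=\lfloor L_k^{4/3}\rfloor+1$ for $k\ge 0$. **Theorem.** For any $m>0$, any $p>16d$ and any integer $L_0>2$ there exist $g_0<\infty$ and $b>0$ such that for any $g$ with $|g|\ge g_0$, all $k\ge 0$ and all $u\in\mathbb Z^d$, $$\mathbb P\{\mathrm B_{L_k}(u)\text{ is }m\text{-non-localized}\}\le L_k^{-p(1+b)^k}.$$ -/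

import Mathlib

open MeasureTheory ProbabilityTheory

noncomputable section

namespace Anderson

/-- The lattice `ℤ^d`. Mathlib's norm on it is the max-norm. -/
abbrev Zd (d : ℕ) : Type := Fin d → ℤ

/-- The lattice ball of radius `L` centred at `u` for the max-norm. -/
def ball {d : ℕ} (u : Zd d) (L : ℕ) : Finset (Zd d) :=
  Finset.Icc (fun i => u i - (L : ℤ)) (fun i => u i + (L : ℤ))

theorem mem_ball {d : ℕ} (u x : Zd d) (L : ℕ) :
    x ∈ ball u L ↔ ‖x - u‖ ≤ (L : ℝ) := by
  rw [pi_norm_le_iff_of_nonneg (Nat.cast_nonneg L), ball, Finset.mem_Icc, Pi.le_def, Pi.le_def,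
    ← forall_and]
  refine forall_congr' fun i => ?_
  rw [Pi.sub_apply, Int.norm_eq_abs, ← Int.cast_abs, ← Int.cast_natCast (R := ℝ), Int.cast_le,
    abs_le]
  constructor <;> rintro ⟨h1, h2⟩ <;> constructor <;> linarith

/-- The nearest-neighbour lattice Laplacian
`(Δψ)(x) = ∑_{y : |y - x|₁ = 1} (ψ(y) - ψ(x))`. -/
def laplacian (d : ℕ) : (Zd d → ℂ) →ₗ[ℂ] (Zd d → ℂ) where
  toFun ψ x := ∑ i : Fin d,
    ((ψ (x + Pi.single i 1) - ψ x) + (ψ (x - Pi.single i 1) - ψ x))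
  map_add' ψ φ := by
    funext x
    simp only [Pi.add_apply, ← Finset.sum_add_distrib]
    exact Finset.sum_congr rfl fun i _ => by ring
  map_smul' c ψ := by
    funext x
    simp only [Pi.smul_apply, smul_eq_mul, RingHom.id_apply, Finset.mul_sum]
    exact Finset.sum_congr rfl fun i _ => by ring

/-- Multiplication by a real potential `v`. -/
def potential {d : ℕ} (v : Zd d → ℝ) : (Zd d → ℂ) →ₗ[ℂ] (Zd d → ℂ) where
  toFun ψ x := (v x : ℂ) * ψ x
  map_add' ψ φ := by
    funext x
    simp only [Pi.add_apply]
    ring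
  map_smul' c ψ := by
    funext x
    simp only [Pi.smul_apply, smul_eq_mul, RingHom.id_apply]
    ring

/-- The Hamiltonian `H = -Δ + g v` on the whole lattice. -/
def hamiltonian {d : ℕ} (g : ℝ) (v : Zd d → ℝ) : (Zd d → ℂ) →ₗ[ℂ] (Zd d → ℂ) :=
  -laplacian d + (g : ℂ) • potential v

/-- The Hamiltonian on a finite set `B` with Dirichlet boundary conditions: extend a function
on `B` by zero to the lattice, apply `H`, and restrict the result to `B`. -/
def dirichletHamiltonian {d : ℕ} (g : ℝ) (v : Zd d → ℝ) (B : Finset (Zd d)) :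
    Module.End ℂ (B → ℂ) :=
  LinearMap.funLeft ℂ ℂ (Subtype.val : B → Zd d) ∘ₗ hamiltonian g v ∘ₗ
    Function.ExtendByZero.linearMap ℂ (Subtype.val : B → Zd d)

/-- The decay exponent `γ(m, L) = m (1 + L^{-1/8})`. -/
def gammaExp (m : ℝ) (L : ℕ) : ℝ := m * (1 + (L : ℝ) ^ (-(1 / 8) : ℝ))

/-- The ball of radius `L` centred at `u` is `m`-localized: every `ℓ²`-normalized eigenfunction
of `H` on the ball satisfies `|ψ(x)| |ψ(y)| ≤ e^{-γ(m, L) ‖x - y‖}`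
whenever `‖x - y‖ ≥ L^{7/8}`. -/
def IsLocalized {d : ℕ} (m g : ℝ) (v : Zd d → ℝ) (u : Zd d) (L : ℕ) : Prop :=
  ∀ (E : ℂ) (ψ : ball u L → ℂ),
    (dirichletHamiltonian g v (ball u L)).HasEigenvector E ψ → ∑ x, ‖ψ x‖ ^ 2 = 1 →
    ∀ x y : ball u L, (L : ℝ) ^ (7 / 8 : ℝ) ≤ ‖(x : Zd d) - (y : Zd d)‖ →
      ‖ψ x‖ * ‖ψ y‖ ≤ Real.exp (-(gammaExp m L * ‖(x : Zd d) - (y : Zd d)‖))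

/-- The length scales `L_{k+1} = ⌊L_k^{4/3}⌋ + 1`. -/
def scale (L₀ : ℕ) : ℕ → ℕ
  | 0 => L₀
  | k + 1 => ⌊(scale L₀ k : ℝ) ^ (4 / 3 : ℝ)⌋₊ + 1

/-- Uniform Hölder continuity of the distribution function `F` of a law on `ℝ`:
`F(t + ε) - F(t) ≤ C ε^θ` for all real `t` and `ε ∈ [0, 1]`. -/
def HolderCDF (μ : Measure ℝ) : Prop :=
  ∃ C θ : ℝ, 0 < θ ∧ ∀ t ε : ℝ, 0 ≤ ε → ε ≤ 1 → cdf μ (t + ε) - cdf μ t ≤ C * ε ^ θ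

end Anderson

end

noncomputable section

namespace Anderson

open scoped ENNReal

/-! ### Singular integrals against Hölder continuous laws -/

section HolderLaws

/-! No induction on scales is used: at strong disorder every ball is treated directly, by fractional
moments of Green functions and an independence argument for pairs of sites.

Hölder continuity bounds the `s`-th moment of `1 / (V - b)` uniformly in `b`, for some small `s`;
replacing `V` by `gV` gains `|g|^{-s}`. Expanding the Green function at its first site, whose
potential enters only through `(g v i - a)⁻¹`, each step of the expansion costs a factor `q` that is
small for large `|g|`. Hence the moments at a fixed energy decay like `q^dist`, uniformly in the
finite set (`lintegral_inv_cutMatrix_rpow_le`).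

Localization requires all energies at once. For distant `x` and `y`, take disjoint neighbourhoods
`Sx`, `Sy` of radius `r`, on which the potentials are independent, and let `t` be exponentially
small in `r`. If `E` is far from every `g v` on `Sx`, the eigenvalue equation makes `φ x` small.
Otherwise `Sx` confines `E` to few points of a grid of step `t^7`, and independence makes the Green
function of `Sy` decay at all of them. This passes from the grid to `E`, and `φ y` is small, unless
`E` nearly hits the spectrum of `Sy`. In that case `Sy` confines `E` to few points of a coarser grid
of step `t^3`, at which `Sx` is well behaved by independence, and `φ x` is small. So off an event of
probability of order `t^s`, up to a power of the volume, every `E` is harmless at `x` or at `y`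
(`abs_eigenfunction_le_or`, `measure_not_abs_eigenfunction_le_or`).

Summing over pairs gives a failure probability of order `L^{16d} exp(-c L^{7/8})`, with `c` as large
as desired. As `(4/3)^k ≤ log L_k`, the claim with `b = 1/3` asks for at most `exp(-p (log L_k)^2)`,
which is much weaker. -/

theorem HolderCDF.exists_measure_Icc_le {μ : Measure ℝ} [IsProbabilityMeasure μ]
    (h : HolderCDF μ) : ∃ C θ : ℝ, 0 < C ∧ 0 < θ ∧
      ∀ b ε : ℝ, 0 < ε → μ (Set.Icc (b - ε) (b + ε)) ≤ ENNReal.ofReal (C * ε ^ θ) := by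
  obtain ⟨C, θ, hθ, hC⟩ := h
  -- The distribution function measures half-open intervals, so the closed interval of length `2ε`
  -- is put into one of length `3ε`. The maximum with `1` makes the bound trivial once `3ε > 1`.
  refine ⟨max C 1 * 3 ^ θ, θ, by positivity, hθ, fun b ε hε => ?_⟩
  have h1 : max C 1 * 3 ^ θ * ε ^ θ = max C 1 * (3 * ε) ^ θ := by
    rw [Real.mul_rpow (by norm_num) hε.le, mul_assoc]
  rw [h1]
  rcases le_or_gt (3 * ε) 1 with h3 | h3
  · have hsub : Set.Icc (b - ε) (b + ε) ⊆ Set.Ioc (b - 2 * ε) (b - 2 * ε + 3 * ε) := by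
      rintro x ⟨hx1, hx2⟩
      exact ⟨by linarith, by linarith⟩
    refine (measure_mono hsub).trans ?_
    have : μ (Set.Ioc (b - 2 * ε) (b - 2 * ε + 3 * ε)) =
        ENNReal.ofReal (cdf μ (b - 2 * ε + 3 * ε) - cdf μ (b - 2 * ε)) := by
      rw [← StieltjesFunction.measure_Ioc, measure_cdf]
    rw [this]
    refine ENNReal.ofReal_le_ofReal ((hC _ _ (by linarith) h3).trans ?_)
    gcongr
    exact le_max_left _ _
  · refine prob_le_one.trans ?_
    rw [← ENNReal.ofReal_one]
    refine ENNReal.ofReal_le_ofReal ?_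
    have h4 : 1 ≤ (3 * ε) ^ θ := Real.one_le_rpow h3.le hθ.le
    nlinarith [le_max_right C 1]

theorem HolderCDF.measure_singleton {μ : Measure ℝ} [IsProbabilityMeasure μ]
    (h : HolderCDF μ) (b : ℝ) : μ {b} = 0 := by
  obtain ⟨C, θ, hC0, hθ, hC⟩ := h.exists_measure_Icc_le
  have hlim : Filter.Tendsto (fun ε : ℝ => ENNReal.ofReal (C * ε ^ θ))
      (nhdsWithin 0 (Set.Ioi 0)) (nhds 0) := by
    have : Filter.Tendsto (fun ε : ℝ => C * ε ^ θ) (nhds 0) (nhds (C * 0 ^ θ)) :=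
      ((Real.continuousAt_rpow_const 0 θ (Or.inr hθ.le)).tendsto).const_mul C
    rw [Real.zero_rpow hθ.ne', mul_zero] at this
    simpa using ENNReal.tendsto_ofReal (this.mono_left nhdsWithin_le_nhds)
  refine le_antisymm (ge_of_tendsto hlim ?_) zero_le
  filter_upwards [self_mem_nhdsWithin] with ε hε
  refine (measure_mono ?_).trans (hC b ε hε)
  rintro x rfl
  exact ⟨by linarith [Set.mem_Ioi.1 hε], by linarith [Set.mem_Ioi.1 hε]⟩

/-- Dyadic shells: if `2^{-(n+1)} < |x - b| ≤ 2^{-n}`, the `n`-th term alone dominates. The summand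
`1` covers `|x - b| ≥ 1`, and at `x = b` the inverse is `0` by convention. -/
theorem enorm_inv_rpow_le_tsum {s : ℝ} (hs : 0 < s) (x b : ℝ) :
    ‖(x - b)⁻¹‖ₑ ^ s ≤ 1 + ∑' n : ℕ, (Set.Icc (b - (1 / 2) ^ n) (b + (1 / 2) ^ n)).indicator
      (fun _ => ENNReal.ofReal (((2 : ℝ) ^ (n + 1)) ^ s)) x := by
  have key : ‖(x - b)⁻¹‖ₑ = ENNReal.ofReal (|x - b|⁻¹) := by
    rw [← ofReal_norm, norm_inv, Real.norm_eq_abs]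
  rw [key, ENNReal.ofReal_rpow_of_nonneg (by positivity) hs.le]
  rcases eq_or_ne (x - b) 0 with h0 | h0
  · simp [h0, Real.zero_rpow hs.ne']
  have hpos : 0 < |x - b| := abs_pos.2 h0
  rcases le_or_gt 1 |x - b| with h1 | h1
  · refine le_trans ?_ le_self_add
    rw [← ENNReal.ofReal_one]
    exact ENNReal.ofReal_le_ofReal (Real.rpow_le_one (by positivity)
      (inv_le_one_of_one_le₀ h1) hs.le)
  · obtain ⟨n, hn1, hn2⟩ := exists_nat_pow_near_of_lt_one hpos h1.le
      (by norm_num : (0 : ℝ) < 1 / 2) (by norm_num)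
    refine le_trans (le_trans ?_ (ENNReal.le_tsum n)) le_add_self
    rw [Set.indicator_of_mem]
    · refine ENNReal.ofReal_le_ofReal (Real.rpow_le_rpow (by positivity) ?_ hs.le)
      rw [inv_le_comm₀ hpos (by positivity)]
      rw [one_div, inv_pow] at hn1
      exact hn1.le
    · have := abs_le.1 hn2
      exact ⟨by linarith, by linarith⟩

/-- Any `s < θ` works: the shell of radius `2^{-n}` has mass of order `2^{-nθ}` and weight
`2^{(n+1)s}`, so the series is geometric. The cap `s ≤ 1` is kept for the subadditivity of the
`s`-th power. -/
theorem HolderCDF.exists_lintegral_inv_rpow_le {μ : Measure ℝ} [IsProbabilityMeasure μ]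
    (h : HolderCDF μ) : ∃ s K : ℝ, 0 < s ∧ s ≤ 1 ∧ 0 < K ∧
      ∀ b : ℝ, ∫⁻ x, ‖(x - b)⁻¹‖ₑ ^ s ∂μ ≤ ENNReal.ofReal K := by
  obtain ⟨C, θ, hC0, hθ, hC⟩ := h.exists_measure_Icc_le
  obtain ⟨s, hs, hs1, hsθ⟩ : ∃ s : ℝ, 0 < s ∧ s ≤ 1 ∧ s < θ :=
    ⟨min 1 (θ / 2), by positivity, min_le_left _ _, (min_le_right _ _).trans_lt (by linarith)⟩
  set ρ : ℝ := 2 ^ s * (1 / 2) ^ θ with hρ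
  have hρ1 : ρ < 1 := by
    rw [hρ, one_div, Real.inv_rpow (by norm_num), ← div_eq_mul_inv, div_lt_one (by positivity)]
    exact Real.rpow_lt_rpow_of_exponent_lt (by norm_num) hsθ
  have hρ0 : 0 < ρ := by positivity
  have hterm : ∀ n : ℕ, ((2 : ℝ) ^ (n + 1)) ^ s * (C * ((1 / 2) ^ n) ^ θ) = 2 ^ s * C * ρ ^ n := by
    intro n
    rw [hρ, mul_pow, ← Real.rpow_natCast (2 ^ s) n, ← Real.rpow_natCast ((1 / 2) ^ θ) n,
      ← Real.rpow_mul (by norm_num), ← Real.rpow_mul (by norm_num), mul_comm s, mul_comm θ,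
      Real.rpow_mul (by norm_num), Real.rpow_mul (by norm_num), Real.rpow_natCast,
      Real.rpow_natCast, pow_succ, Real.mul_rpow (by positivity) (by norm_num)]
    ring
  have hsum : Summable fun n : ℕ => 2 ^ s * C * ρ ^ n :=
    (summable_geometric_of_lt_one hρ0.le hρ1).mul_left _
  refine ⟨s, 1 + ∑' n : ℕ, 2 ^ s * C * ρ ^ n, hs, hs1,
    add_pos_of_pos_of_nonneg one_pos (tsum_nonneg fun n => by positivity), fun b => ?_⟩
  calc ∫⁻ x, ‖(x - b)⁻¹‖ₑ ^ s ∂μ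
      ≤ ∫⁻ x, (1 + ∑' n : ℕ, (Set.Icc (b - (1 / 2) ^ n) (b + (1 / 2) ^ n)).indicator
          (fun _ => ENNReal.ofReal (((2 : ℝ) ^ (n + 1)) ^ s)) x) ∂μ :=
        lintegral_mono fun x => enorm_inv_rpow_le_tsum hs x b
    _ = 1 + ∑' n : ℕ, ENNReal.ofReal (((2 : ℝ) ^ (n + 1)) ^ s) *
          μ (Set.Icc (b - (1 / 2) ^ n) (b + (1 / 2) ^ n)) := by
        rw [lintegral_add_left measurable_const, lintegral_tsum
          fun n => (measurable_const.indicator measurableSet_Icc).aemeasurable]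
        simp [lintegral_indicator_const measurableSet_Icc]
    _ ≤ 1 + ∑' n : ℕ, ENNReal.ofReal (2 ^ s * C * ρ ^ n) := by
        gcongr with n
        rw [← hterm, ENNReal.ofReal_mul (by positivity)]
        gcongr
        exact hC b _ (by positivity)
    _ = ENNReal.ofReal (1 + ∑' n : ℕ, 2 ^ s * C * ρ ^ n) := by
        rw [ENNReal.ofReal_add zero_le_one (tsum_nonneg fun n => by positivity),
          ENNReal.ofReal_tsum_of_nonneg (fun n => by positivity) hsum, ENNReal.ofReal_one]

theorem lintegral_inv_affine_rpow_le {μ : Measure ℝ} {s K g : ℝ} (hs : 0 < s) (hg : g ≠ 0)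
    (h : ∀ b : ℝ, ∫⁻ x, ‖(x - b)⁻¹‖ₑ ^ s ∂μ ≤ ENNReal.ofReal K) (a : ℝ) :
    ∫⁻ x, ‖(g * x - a)⁻¹‖ₑ ^ s ∂μ ≤ ENNReal.ofReal (K / |g| ^ s) := by
  have h1 : ∀ x : ℝ, ‖(g * x - a)⁻¹‖ₑ ^ s =
      ENNReal.ofReal (|g| ^ s)⁻¹ * ‖(x - a / g)⁻¹‖ₑ ^ s := by
    intro x
    have : (g * x - a)⁻¹ = g⁻¹ * (x - a / g)⁻¹ := by
      rw [← mul_inv, mul_sub, mul_div_cancel₀ _ hg]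
    rw [this, enorm_mul, ENNReal.mul_rpow_of_nonneg _ _ hs.le, ← ofReal_norm g⁻¹,
      norm_inv, Real.norm_eq_abs, ENNReal.ofReal_rpow_of_nonneg (by positivity) hs.le,
      Real.inv_rpow (abs_nonneg g)]
  simp_rw [h1]
  rw [lintegral_const_mul' _ _ ENNReal.ofReal_ne_top, div_eq_inv_mul K,
    ENNReal.ofReal_mul (by positivity)]
  gcongr
  exact h _

end HolderLaws

/-! ### Green functions of restricted Hamiltonians -/

section GreenFunctions

variable {ι : Type*} [DecidableEq ι]

/-- The matrix `T + g v - E` restricted to `Λ`, completed by the identity outside `Λ`. -/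
def cutMatrix (T : Matrix ι ι ℝ) (g E : ℝ) (Λ : Finset ι) (v : ι → ℝ) : Matrix ι ι ℝ :=
  Matrix.of fun i j => if i ∈ Λ ∧ j ∈ Λ then T i j + (if i = j then g * v i - E else 0)
    else if i = j then 1 else 0

theorem continuous_cutMatrix (T : Matrix ι ι ℝ) (g E : ℝ) (Λ : Finset ι) :
    Continuous (cutMatrix T g E Λ) := by
  refine continuous_matrix fun i j => ?_
  simp only [cutMatrix, Matrix.of_apply]
  split_ifs <;> fun_prop

theorem cutMatrix_update (T : Matrix ι ι ℝ) (g E : ℝ) {Λ : Finset ι} {i : ι} (hi : i ∉ Λ)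
    (v : ι → ℝ) (t : ℝ) : cutMatrix T g E Λ (Function.update v i t) = cutMatrix T g E Λ v := by
  ext k l
  simp only [cutMatrix, Matrix.of_apply]
  refine if_ctx_congr Iff.rfl (fun h => ?_) fun _ => rfl
  rw [Function.update_of_ne]
  rintro rfl
  exact hi h.1

variable [Fintype ι]

/-- The self-energy at `i` generated by the sites of `Λ` other than `i`, shifted so that the
diagonal Green function at `i` is `(g v i - a)⁻¹`. -/
def selfEnergy (T : Matrix ι ι ℝ) (g E : ℝ) (Λ : Finset ι) (i : ι) (v : ι → ℝ) : ℝ :=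
  E - T i i + ∑ k ∈ Λ.erase i,
    (∑ l ∈ Λ.erase i, T i l * (cutMatrix T g E (Λ.erase i) v)⁻¹ l k) * T k i

theorem measurable_det_cutMatrix (T : Matrix ι ι ℝ) (g E : ℝ) (Λ : Finset ι) :
    Measurable fun v => (cutMatrix T g E Λ v).det :=
  (continuous_cutMatrix T g E Λ).matrix_det.measurable

theorem measurable_inv_cutMatrix (T : Matrix ι ι ℝ) (g E : ℝ) (Λ : Finset ι) (i j : ι) :
    Measurable fun v => (cutMatrix T g E Λ v)⁻¹ i j := by
  simp only [Matrix.inv_def, Matrix.smul_apply, Ring.inverse_eq_inv', smul_eq_mul]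
  exact (measurable_det_cutMatrix T g E Λ).inv.mul
    ((continuous_cutMatrix T g E Λ).matrix_adjugate.matrix_elem i j).measurable

theorem measurable_selfEnergy (T : Matrix ι ι ℝ) (g E : ℝ) (Λ : Finset ι) (i : ι) :
    Measurable (selfEnergy T g E Λ i) := by
  unfold selfEnergy
  exact measurable_const.add (Finset.measurable_fun_sum _ fun k _ =>
    (Finset.measurable_fun_sum _ fun l _ =>
      (measurable_inv_cutMatrix T g E _ l k).const_mul _).mul_const _)

/-- This allows `v i` to be integrated first, with the self-energy at `i` frozen. -/
theorem selfEnergy_update (T : Matrix ι ι ℝ) (g E : ℝ) (Λ : Finset ι) (i : ι)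
    (v : ι → ℝ) (t : ℝ) :
    selfEnergy T g E Λ i (Function.update v i t) = selfEnergy T g E Λ i v := by
  simp only [selfEnergy, cutMatrix_update T g E (Finset.notMem_erase i Λ)]

/-- Schur complement for row vectors. Only the matrix with `i` deleted has to be invertible: `c = 0`
then controls the kernel of the full matrix, and `c = 1` gives a row of its inverse. -/
theorem vecMul_cutMatrix_eq_single {T : Matrix ι ι ℝ} {g E : ℝ} {Λ : Finset ι} {i : ι}
    (hi : i ∈ Λ) {v : ι → ℝ} (hdet : (cutMatrix T g E (Λ.erase i) v).det ≠ 0)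
    {ρ : ι → ℝ} {c : ℝ} (hρ : Matrix.vecMul ρ (cutMatrix T g E Λ v) = Pi.single i c) :
    ρ i * (g * v i - selfEnergy T g E Λ i v) = c ∧
      ∀ j ≠ i, ρ j = -(ρ i * ∑ l ∈ Λ.erase i, T i l *
        (cutMatrix T g E (Λ.erase i) v)⁻¹ l j) := by
  set A := cutMatrix T g E Λ v with hA
  set B := cutMatrix T g E (Λ.erase i) v with hB
  set w : ι → ℝ := fun l => if l ∈ Λ.erase i then T i l else 0 with hw
  set ρ' := Function.update ρ i 0 with hρ'
  have hwsum : ∀ f : ι → ℝ, ∑ l, w l * f l = ∑ l ∈ Λ.erase i, T i l * f l := by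
    intro f
    simp only [hw, ite_mul, zero_mul]
    rw [Finset.sum_ite_mem, Finset.univ_inter]
  -- Away from row and column `i` the two matrices agree, so deleting the coordinate `ρ i` only
  -- moves its contribution to the right-hand side.
  have h1 : Matrix.vecMul ρ' B = -(ρ i) • w := by
    funext j
    rw [Matrix.vecMul, dotProduct, Pi.smul_apply, smul_eq_mul]
    by_cases hj : j = i
    · subst hj
      have : w j = 0 := by simp [hw]
      rw [this, mul_zero]
      refine Finset.sum_eq_zero fun k _ => ?_
      by_cases hk : k = j
      · simp [hρ', hk]
      · simp [hB, cutMatrix, hk]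
    · have hcol := congrFun hρ j
      rw [Pi.single_eq_of_ne hj, Matrix.vecMul, dotProduct,
        ← Finset.add_sum_erase _ _ (Finset.mem_univ i)] at hcol
      rw [← Finset.add_sum_erase _ _ (Finset.mem_univ i)]
      have hAij : A i j = w j := by
        simp [hA, hw, cutMatrix, hi, hj, Ne.symm hj]
      have hrest : ∑ k ∈ Finset.univ.erase i, ρ' k * B k j =
          ∑ k ∈ Finset.univ.erase i, ρ k * A k j := by
        refine Finset.sum_congr rfl fun k hk => ?_
        have hki := Finset.ne_of_mem_erase hk
        simp [hρ', hA, hB, cutMatrix, hki, hj]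
      rw [hrest, hρ', Function.update_self]
      rw [hAij] at hcol
      linarith
  have h2 : ρ' = -(ρ i) • Matrix.vecMul w B⁻¹ := by
    rw [← Matrix.smul_vecMul, ← h1, Matrix.vecMul_vecMul,
      Matrix.mul_nonsing_inv _ (isUnit_iff_ne_zero.2 hdet), Matrix.vecMul_one]
  have h3 : ∀ j, ρ' j = -(ρ i * ∑ l ∈ Λ.erase i, T i l * B⁻¹ l j) := by
    intro j
    rw [h2, Pi.smul_apply, Matrix.vecMul, dotProduct, hwsum, smul_eq_mul, neg_mul]
  refine ⟨?_, fun j hj => ?_⟩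
  · have hcol := congrFun hρ i
    rw [Pi.single_eq_same, Matrix.vecMul, dotProduct,
      ← Finset.add_sum_erase _ _ (Finset.mem_univ i)] at hcol
    have hAii : A i i = T i i + (g * v i - E) := by simp [hA, cutMatrix, hi]
    have hrest : ∑ k ∈ Finset.univ.erase i, ρ k * A k i =
        ∑ k ∈ Λ.erase i, ρ' k * T k i := by
      rw [← Finset.sum_subset (Finset.erase_subset_erase i (Finset.subset_univ Λ))]
      · refine Finset.sum_congr rfl fun k hk => ?_
        have hki := Finset.ne_of_mem_erase hk
        simp [hρ', hA, cutMatrix, hki, Finset.mem_of_mem_erase hk, hi]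
      · intro k hk hk'
        have hki := Finset.ne_of_mem_erase hk
        have : k ∉ Λ := fun h => hk' (Finset.mem_erase.2 ⟨hki, h⟩)
        simp [hA, cutMatrix, hki, this]
    rw [hrest, hAii] at hcol
    simp_rw [h3] at hcol
    rw [← hcol, selfEnergy, ← hB]
    have : ∑ k ∈ Λ.erase i, -(ρ i * ∑ l ∈ Λ.erase i, T i l * B⁻¹ l k) * T k i =
        -(ρ i * ∑ k ∈ Λ.erase i, (∑ l ∈ Λ.erase i, T i l * B⁻¹ l k) * T k i) := by
      rw [Finset.mul_sum, ← Finset.sum_neg_distrib]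
      exact Finset.sum_congr rfl fun k _ => by ring
    rw [this]
    ring
  · rw [← h3, hρ', Function.update_of_ne hj]

theorem det_cutMatrix_ne_zero {T : Matrix ι ι ℝ} {g E : ℝ} {Λ : Finset ι} {i : ι}
    (hi : i ∈ Λ) {v : ι → ℝ} (hdet : (cutMatrix T g E (Λ.erase i) v).det ≠ 0)
    (hv : g * v i ≠ selfEnergy T g E Λ i v) : (cutMatrix T g E Λ v).det ≠ 0 := by
  intro h0
  obtain ⟨ρ, hρ0, hρ⟩ := Matrix.exists_vecMul_eq_zero_iff.2 h0
  rw [← Pi.single_zero i] at hρ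
  obtain ⟨h1, h2⟩ := vecMul_cutMatrix_eq_single hi hdet hρ
  have hρi : ρ i = 0 := (mul_eq_zero.1 h1).resolve_right (sub_ne_zero.2 hv)
  refine hρ0 (funext fun j => ?_)
  by_cases hj : j = i
  · rw [hj, hρi, Pi.zero_apply]
  · rw [h2 j hj, hρi, zero_mul, neg_zero, Pi.zero_apply]

theorem inv_cutMatrix_row {T : Matrix ι ι ℝ} {g E : ℝ} {Λ : Finset ι} {i : ι}
    (hi : i ∈ Λ) {v : ι → ℝ} (hdet : (cutMatrix T g E (Λ.erase i) v).det ≠ 0)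
    (hdet' : (cutMatrix T g E Λ v).det ≠ 0) :
    (cutMatrix T g E Λ v)⁻¹ i i = (g * v i - selfEnergy T g E Λ i v)⁻¹ ∧
      ∀ j ≠ i, (cutMatrix T g E Λ v)⁻¹ i j = -((g * v i - selfEnergy T g E Λ i v)⁻¹ *
        ∑ l ∈ Λ.erase i, T i l * (cutMatrix T g E (Λ.erase i) v)⁻¹ l j) := by
  have hρ : Matrix.vecMul ((cutMatrix T g E Λ v)⁻¹ i) (cutMatrix T g E Λ v) =
      Pi.single i 1 := by
    rw [← Matrix.mul_apply_eq_vecMul, Matrix.nonsing_inv_mul _ (isUnit_iff_ne_zero.2 hdet')]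
    funext j
    simp [Matrix.one_apply, Pi.single_apply, eq_comm]
  obtain ⟨h1, h2⟩ := vecMul_cutMatrix_eq_single hi hdet hρ
  have h3 := eq_inv_of_mul_eq_one_left h1
  exact ⟨h3, fun j hj => by rw [h2 j hj, h3]⟩

theorem lintegral_pi_le_of_forall_update {μ : Measure ℝ} [IsProbabilityMeasure μ]
    {f h : (ι → ℝ) → ℝ≥0∞} (hf : Measurable f) (hh : Measurable h) (i : ι)
    (hle : ∀ v, ∫⁻ t, f (Function.update v i t) ∂μ ≤ ∫⁻ t, h (Function.update v i t) ∂μ) :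
    ∫⁻ v, f v ∂(Measure.pi fun _ : ι => μ) ≤ ∫⁻ v, h v ∂(Measure.pi fun _ : ι => μ) := by
  refine lintegral_le_of_lmarginal_le {i} hf hh ?_
  rw [lmarginal_singleton, lmarginal_singleton]
  exact hle

/-- Adding a site `i` can destroy invertibility only if `g v i` equals the self-energy. The latter
does not depend on `v i`, and the law has no atoms. -/
theorem ae_det_cutMatrix_ne_zero {μ : Measure ℝ} [IsProbabilityMeasure μ] {g : ℝ}
    (hatom : ∀ a, μ {t | g * t = a} = 0) (T : Matrix ι ι ℝ) (E : ℝ) (Λ : Finset ι) :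
    ∀ᵐ v ∂(Measure.pi fun _ : ι => μ), (cutMatrix T g E Λ v).det ≠ 0 := by
  induction Λ using Finset.induction_on with
  | empty =>
    refine Filter.Eventually.of_forall fun v => ?_
    have : cutMatrix T g E ∅ v = 1 := by
      ext i j
      simp [cutMatrix, Matrix.one_apply]
    simp [this]
  | insert i Λ hi ih =>
    have hms : MeasurableSet {v : ι → ℝ | g * v i = selfEnergy T g E (insert i Λ) i v} :=
      measurableSet_eq_fun (by fun_prop) (measurable_selfEnergy T g E (insert i Λ) i)
    have hnull : (Measure.pi fun _ : ι => μ)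
        {v : ι → ℝ | g * v i = selfEnergy T g E (insert i Λ) i v} = 0 := by
      rw [← lintegral_indicator_one hms]
      refine le_antisymm ?_ zero_le
      rw [← lintegral_zero (μ := Measure.pi fun _ : ι => μ)]
      refine lintegral_pi_le_of_forall_update (measurable_one.indicator hms) measurable_const i
        fun v => ?_
      have : ∀ t, ({v : ι → ℝ | g * v i = selfEnergy T g E (insert i Λ) i v}.indicator
          (1 : (ι → ℝ) → ℝ≥0∞)) (Function.update v i t) =
          {t | g * t = selfEnergy T g E (insert i Λ) i v}.indicator 1 t := by
        intro t
        simp [Set.indicator_apply, selfEnergy_update]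
      simp_rw [this]
      have hms' : MeasurableSet {t : ℝ | g * t = selfEnergy T g E (insert i Λ) i v} :=
        measurableSet_eq_fun (by fun_prop) measurable_const
      rw [lintegral_indicator_one hms', hatom, lintegral_zero]
    have hae : ∀ᵐ v ∂(Measure.pi fun _ : ι => μ),
        g * v i ≠ selfEnergy T g E (insert i Λ) i v := measure_eq_zero_iff_ae_notMem.1 hnull
    filter_upwards [ih, hae] with v h1 h2
    refine det_cutMatrix_ne_zero (Finset.mem_insert_self i Λ) ?_ h2
    rwa [Finset.erase_insert hi]

theorem enorm_sum_rpow_le {α : Type*} (S : Finset α) (f : α → ℝ) {s : ℝ} (hs : 0 < s)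
    (hs1 : s ≤ 1) : ‖∑ k ∈ S, f k‖ₑ ^ s ≤ ∑ k ∈ S, ‖f k‖ₑ ^ s := by
  classical
  induction S using Finset.induction_on with
  | empty => simp [hs]
  | insert a S ha ih =>
    rw [Finset.sum_insert ha, Finset.sum_insert ha]
    calc ‖f a + ∑ k ∈ S, f k‖ₑ ^ s ≤ (‖f a‖ₑ + ‖∑ k ∈ S, f k‖ₑ) ^ s :=
          ENNReal.rpow_le_rpow (enorm_add_le _ _) hs.le
      _ ≤ ‖f a‖ₑ ^ s + ‖∑ k ∈ S, f k‖ₑ ^ s := ENNReal.rpow_add_le_add_rpow _ _ hs.le hs1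
      _ ≤ _ := by gcongr

/-- Fractional moments of the Green function decay exponentially at strong disorder. -/
theorem lintegral_inv_cutMatrix_rpow_le {μ : Measure ℝ} [IsProbabilityMeasure μ]
    {g s A D q : ℝ} (hs : 0 < s) (hs1 : s ≤ 1) (hatom : ∀ a, μ {t | g * t = a} = 0)
    (hA : ∀ a, ∫⁻ t, ‖(g * t - a)⁻¹‖ₑ ^ s ∂μ ≤ ENNReal.ofReal A) (hA0 : 0 ≤ A) (hA1 : A ≤ 1)
    (hD : 0 ≤ D) (hAD : A * D ≤ q) (hq : q ≤ 1)
    {T : Matrix ι ι ℝ} (hT : ∀ i, ∑ k, ‖T i k‖ₑ ^ s ≤ ENNReal.ofReal D)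
    {n : ι → ι → ℕ} (hn0 : ∀ i, n i i = 0)
    (hn : ∀ i j k, T i k ≠ 0 → n i j ≤ n k j + 1) (E : ℝ) (Λ : Finset ι) {i j : ι}
    (hi : i ∈ Λ) (hj : j ∈ Λ) :
    ∫⁻ v, ‖(cutMatrix T g E Λ v)⁻¹ i j‖ₑ ^ s ∂(Measure.pi fun _ : ι => μ) ≤
      ENNReal.ofReal (q ^ n i j) := by
  have hq0 : 0 ≤ q := (mul_nonneg hA0 hD).trans hAD
  -- Up to sign, the entry `(i, j)` is `(g v i - a)⁻¹` times a sum over `l` of `T i l` and the entry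
  -- `(l, j)` for `Λ.erase i`. Only the first factor contains `v i`, so integrating it out costs
  -- `A`, the sum costs `D`, and `n` drops by at most one.
  induction Λ using Finset.strongInduction generalizing i j with
  | H Λ ih =>
  have hae := (ae_det_cutMatrix_ne_zero hatom T E Λ).and
    (ae_det_cutMatrix_ne_zero hatom T E (Λ.erase i))
  have hmk : Measurable fun v : ι → ℝ => ‖(g * v i - selfEnergy T g E Λ i v)⁻¹‖ₑ ^ s :=
    ((((measurable_pi_apply i).const_mul g).sub
      (measurable_selfEnergy T g E Λ i)).inv.enorm).pow_const s
  have hm : ∀ (Λ : Finset ι) k l,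
      Measurable fun v : ι → ℝ => ‖(cutMatrix T g E Λ v)⁻¹ k l‖ₑ ^ s :=
    fun Λ k l => (measurable_inv_cutMatrix T g E Λ k l).enorm.pow_const s
  by_cases hij : j = i
  · subst hij
    calc ∫⁻ v, ‖(cutMatrix T g E Λ v)⁻¹ j j‖ₑ ^ s ∂(Measure.pi fun _ : ι => μ)
        ≤ ∫⁻ v, ‖(g * v j - selfEnergy T g E Λ j v)⁻¹‖ₑ ^ s ∂(Measure.pi fun _ : ι => μ) := by
          refine lintegral_mono_ae (hae.mono fun v hv => ?_)
          rw [(inv_cutMatrix_row hj hv.2 hv.1).1]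
      _ ≤ ∫⁻ _, ENNReal.ofReal A ∂(Measure.pi fun _ : ι => μ) := by
          refine lintegral_pi_le_of_forall_update hmk measurable_const j fun v => ?_
          simpa [selfEnergy_update] using hA _
      _ ≤ ENNReal.ofReal (q ^ n j j) := by
          simpa [hn0] using hA1
  · set f : (ι → ℝ) → ℝ≥0∞ := fun v => ∑ l ∈ Λ.erase i,
      ‖T i l‖ₑ ^ s * ‖(cutMatrix T g E (Λ.erase i) v)⁻¹ l j‖ₑ ^ s with hf
    have hfm : Measurable f :=
      Finset.measurable_fun_sum _ fun l _ => (hm _ l j).const_mul _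
    calc ∫⁻ v, ‖(cutMatrix T g E Λ v)⁻¹ i j‖ₑ ^ s ∂(Measure.pi fun _ : ι => μ)
        ≤ ∫⁻ v, ‖(g * v i - selfEnergy T g E Λ i v)⁻¹‖ₑ ^ s * f v
            ∂(Measure.pi fun _ : ι => μ) := by
          refine lintegral_mono_ae (hae.mono fun v hv => ?_)
          rw [(inv_cutMatrix_row hi hv.2 hv.1).2 j hij, enorm_neg, enorm_mul,
            ENNReal.mul_rpow_of_nonneg _ _ hs.le]
          gcongr
          refine (enorm_sum_rpow_le _ _ hs hs1).trans (le_of_eq ?_)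
          exact Finset.sum_congr rfl fun l _ => by
            rw [enorm_mul, ENNReal.mul_rpow_of_nonneg _ _ hs.le]
      _ ≤ ∫⁻ v, ENNReal.ofReal A * f v ∂(Measure.pi fun _ : ι => μ) := by
          refine lintegral_pi_le_of_forall_update (hmk.mul hfm) (hfm.const_mul _) i fun v => ?_
          have hfu : ∀ t, f (Function.update v i t) = f v := fun t => by
            simp only [hf, cutMatrix_update T g E (Finset.notMem_erase i Λ)]
          simp_rw [hfu, selfEnergy_update, Function.update_self]
          rw [lintegral_mul_const _ (by fun_prop), lintegral_const, measure_univ, mul_one]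
          gcongr
          exact hA _
      _ = ENNReal.ofReal A * ∑ l ∈ Λ.erase i, ‖T i l‖ₑ ^ s *
            ∫⁻ v, ‖(cutMatrix T g E (Λ.erase i) v)⁻¹ l j‖ₑ ^ s
              ∂(Measure.pi fun _ : ι => μ) := by
          rw [lintegral_const_mul _ hfm, hf, lintegral_finsetSum _
            fun l _ => (hm _ l j).const_mul _]
          congr 1
          exact Finset.sum_congr rfl fun l _ => lintegral_const_mul _ (hm _ l j)
      _ ≤ ENNReal.ofReal A * ∑ l ∈ Λ.erase i, ‖T i l‖ₑ ^ s *
            ENNReal.ofReal (q ^ (n i j - 1)) := by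
          refine mul_le_mul_right (Finset.sum_le_sum fun l hl => ?_) _
          by_cases hTl : T i l = 0
          · simp [hTl, hs]
          · gcongr
            refine (ih _ (Finset.erase_ssubset hi) hl (Finset.mem_erase.2 ⟨hij, hj⟩)).trans ?_
            exact ENNReal.ofReal_le_ofReal (pow_le_pow_of_le_one hq0 hq
              (by have := hn i j l hTl; omega))
      _ ≤ ENNReal.ofReal A * (ENNReal.ofReal D * ENNReal.ofReal (q ^ (n i j - 1))) := by
          rw [← Finset.sum_mul]
          gcongr
          exact (Finset.sum_le_univ_sum_of_nonneg fun _ => zero_le).trans (hT i)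
      _ ≤ ENNReal.ofReal (q ^ n i j) := by
          rw [← ENNReal.ofReal_mul hD, ← ENNReal.ofReal_mul hA0, ← mul_assoc]
          refine ENNReal.ofReal_le_ofReal ?_
          rcases Nat.eq_zero_or_pos (n i j) with h0 | h0
          · simpa [h0] using hAD.trans hq
          · calc A * D * q ^ (n i j - 1) ≤ q * q ^ (n i j - 1) := by gcongr
              _ = q ^ n i j := by rw [← pow_succ', Nat.sub_add_cancel h0]

end GreenFunctions

/-! ### Perturbation and counting of resonant energies -/

section Resonances

variable {ι : Type*} [Fintype ι]

/-- The sum of the absolute values of all entries of a matrix. -/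
def entrySum (G : Matrix ι ι ℝ) : ℝ := ∑ i, ∑ j, |G i j|

theorem entrySum_nonneg (G : Matrix ι ι ℝ) : 0 ≤ entrySum G :=
  Finset.sum_nonneg fun _ _ => Finset.sum_nonneg fun _ _ => abs_nonneg _

theorem sum_abs_mulVec_le (G : Matrix ι ι ℝ) (u : ι → ℝ) :
    ∑ i, |(G.mulVec u) i| ≤ entrySum G * ∑ i, |u i| := by
  rw [entrySum, Finset.sum_mul]
  refine Finset.sum_le_sum fun i _ => ?_
  rw [Matrix.mulVec, dotProduct, Finset.sum_mul]
  refine (Finset.abs_sum_le_sum_abs _ _).trans (Finset.sum_le_sum fun j _ => ?_)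
  rw [abs_mul]
  exact mul_le_mul_of_nonneg_left (Finset.single_le_sum (f := fun i => |u i|)
    (fun _ _ => abs_nonneg _) (Finset.mem_univ j)) (abs_nonneg _)

theorem entrySum_mul_le (F G : Matrix ι ι ℝ) : entrySum (F * G) ≤ entrySum F * entrySum G := by
  have hcol : ∀ H : Matrix ι ι ℝ, entrySum H = ∑ j, ∑ i, |H i j| := fun H => Finset.sum_comm
  rw [hcol (F * G), hcol G, Finset.mul_sum]
  refine Finset.sum_le_sum fun j _ => ?_
  exact sum_abs_mulVec_le F fun k => G k j

variable [DecidableEq ι]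

/-- A kernel vector satisfies `u = c M⁻¹ u`, so its `ℓ¹` norm is at most half of itself. The bounds
follow from the resolvent identity `R - M⁻¹ = c R M⁻¹`, absorbing the term in `R`. -/
theorem resolvent_perturbation {M : Matrix ι ι ℝ} (hM : M.det ≠ 0) {c : ℝ}
    (hc : |c| * entrySum M⁻¹ ≤ 1 / 2) :
    (M - c • (1 : Matrix ι ι ℝ)).det ≠ 0 ∧
      entrySum (M - c • (1 : Matrix ι ι ℝ))⁻¹ ≤ 2 * entrySum M⁻¹ ∧
      entrySum ((M - c • (1 : Matrix ι ι ℝ))⁻¹ - M⁻¹) ≤ 2 * |c| * entrySum M⁻¹ ^ 2 := by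
  have hN := entrySum_nonneg M⁻¹
  have hdet : (M - c • (1 : Matrix ι ι ℝ)).det ≠ 0 := by
    intro h0
    obtain ⟨u, hu0, hu⟩ := Matrix.exists_mulVec_eq_zero_iff.2 h0
    rw [Matrix.sub_mulVec, Matrix.smul_mulVec, Matrix.one_mulVec, sub_eq_zero] at hu
    have h1 : u = c • M⁻¹.mulVec u := by
      rw [← Matrix.mulVec_smul, ← hu, Matrix.mulVec_mulVec,
        Matrix.nonsing_inv_mul _ (isUnit_iff_ne_zero.2 hM), Matrix.one_mulVec]
    have h2 : ∑ i, |u i| ≤ 1 / 2 * ∑ i, |u i| := by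
      calc ∑ i, |u i| = |c| * ∑ i, |(M⁻¹.mulVec u) i| := by
            conv_lhs => rw [h1]
            simp [abs_mul, Finset.mul_sum]
        _ ≤ |c| * (entrySum M⁻¹ * ∑ i, |u i|) :=
            mul_le_mul_of_nonneg_left (sum_abs_mulVec_le _ _) (abs_nonneg _)
        _ = |c| * entrySum M⁻¹ * ∑ i, |u i| := by ring
        _ ≤ _ := mul_le_mul_of_nonneg_right hc (Finset.sum_nonneg fun _ _ => abs_nonneg _)
    have h3 : ∑ i, |u i| = 0 :=
      le_antisymm (by linarith) (Finset.sum_nonneg fun _ _ => abs_nonneg _)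
    refine hu0 (funext fun i => ?_)
    exact abs_eq_zero.1 ((Finset.sum_eq_zero_iff_of_nonneg fun _ _ => abs_nonneg _).1 h3 i
      (Finset.mem_univ i))
  set R := (M - c • (1 : Matrix ι ι ℝ))⁻¹ with hR
  have hid : R - M⁻¹ = c • (R * M⁻¹) := by
    have h1 : R * (M - c • (1 : Matrix ι ι ℝ)) * M⁻¹ = M⁻¹ := by
      rw [hR, Matrix.nonsing_inv_mul _ (isUnit_iff_ne_zero.2 hdet), Matrix.one_mul]
    rw [Matrix.mul_sub, Matrix.sub_mul, Matrix.mul_assoc,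
      Matrix.mul_nonsing_inv _ (isUnit_iff_ne_zero.2 hM), Matrix.mul_one, Matrix.mul_smul,
      Matrix.mul_one, Matrix.smul_mul] at h1
    exact sub_eq_iff_eq_add'.2 (sub_eq_iff_eq_add.1 h1)
  have hprod := entrySum_mul_le R M⁻¹
  have hdiff : entrySum (R - M⁻¹) = |c| * entrySum (R * M⁻¹) := by
    simp only [hid, entrySum, Matrix.smul_apply, smul_eq_mul, abs_mul, Finset.mul_sum]
  have hsum : entrySum R ≤ entrySum M⁻¹ + |c| * entrySum (R * M⁻¹) := by
    rw [← hdiff]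
    simp only [entrySum, ← Finset.sum_add_distrib]
    refine Finset.sum_le_sum fun i _ => Finset.sum_le_sum fun j _ => ?_
    rw [Matrix.sub_apply]
    have := abs_add_le (M⁻¹ i j) (R i j - M⁻¹ i j)
    rwa [add_sub_cancel] at this
  have hR0 := entrySum_nonneg R
  have hR2 : entrySum R ≤ 2 * entrySum M⁻¹ := by
    have : |c| * entrySum (R * M⁻¹) ≤ entrySum R * (1 / 2) := by
      calc |c| * entrySum (R * M⁻¹) ≤ |c| * (entrySum R * entrySum M⁻¹) :=
            mul_le_mul_of_nonneg_left hprod (abs_nonneg _)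
        _ = entrySum R * (|c| * entrySum M⁻¹) := by ring
        _ ≤ _ := mul_le_mul_of_nonneg_left hc hR0
    linarith
  refine ⟨hdet, hR2, ?_⟩
  rw [hdiff]
  calc |c| * entrySum (R * M⁻¹) ≤ |c| * (2 * entrySum M⁻¹ * entrySum M⁻¹) := by
        refine mul_le_mul_of_nonneg_left (hprod.trans ?_) (abs_nonneg _)
        exact mul_le_mul_of_nonneg_right hR2 hN
    _ = _ := by ring

/-- In an orthonormal eigenbasis each of the `n²` entries is a sum of `n` terms bounded by `1 / δ`,
where `n` is the dimension. -/
theorem entrySum_resolvent_le {A : Matrix ι ι ℝ} (hA : A.IsHermitian) {E δ : ℝ} (hδ : 0 < δ)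
    (h : ∀ k, δ ≤ |hA.eigenvalues k - E|) :
    (A - E • (1 : Matrix ι ι ℝ)).det ≠ 0 ∧
      entrySum (A - E • (1 : Matrix ι ι ℝ))⁻¹ ≤ (Fintype.card ι : ℝ) ^ 3 / δ := by
  set U : Matrix ι ι ℝ := (hA.eigenvectorUnitary : Matrix ι ι ℝ) with hU
  have hUU : U * star U = 1 := Unitary.coe_mul_star_self _
  have hUU' : star U * U = 1 := Unitary.coe_star_mul_self _
  have hspec : A = U * Matrix.diagonal hA.eigenvalues * star U := by
    conv_lhs => rw [hA.spectral_theorem, Unitary.conjStarAlgAut_apply]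
    rfl
  set W := U * Matrix.diagonal (fun k => (hA.eigenvalues k - E)⁻¹) * star U with hW
  have hne : ∀ k, hA.eigenvalues k - E ≠ 0 := fun k h0 => by
    have := h k
    rw [h0, abs_zero] at this
    linarith
  have hshift : A - E • (1 : Matrix ι ι ℝ) =
      U * Matrix.diagonal (fun k => hA.eigenvalues k - E) * star U := by
    have : Matrix.diagonal (fun k => hA.eigenvalues k - E) =
        Matrix.diagonal hA.eigenvalues - E • (1 : Matrix ι ι ℝ) := by
      ext i j
      by_cases hij : i = j <;> simp [hij]
    rw [this, Matrix.mul_sub, Matrix.sub_mul, ← hspec, Matrix.mul_smul, Matrix.smul_mul,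
      Matrix.mul_one, hUU]
  have hinv : (A - E • (1 : Matrix ι ι ℝ)) * W = 1 := by
    rw [hshift, hW]
    calc U * Matrix.diagonal (fun k => hA.eigenvalues k - E) * star U *
          (U * Matrix.diagonal (fun k => (hA.eigenvalues k - E)⁻¹) * star U)
        = U * (Matrix.diagonal (fun k => hA.eigenvalues k - E) * (star U * U) *
          Matrix.diagonal (fun k => (hA.eigenvalues k - E)⁻¹)) * star U := by
          simp only [Matrix.mul_assoc]
      _ = 1 := by
          rw [hUU', Matrix.mul_one, Matrix.diagonal_mul_diagonal]
          simp only [mul_inv_cancel₀ (hne _)]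
          rw [Matrix.diagonal_one, Matrix.mul_one, hUU]
  refine ⟨?_, ?_⟩
  · intro h0
    have := congrArg Matrix.det hinv
    rw [Matrix.det_mul, h0, zero_mul, Matrix.det_one] at this
    exact zero_ne_one this
  · rw [Matrix.inv_eq_right_inv hinv]
    have hentry : ∀ i j, |W i j| ≤ (Fintype.card ι : ℝ) / δ := by
      intro i j
      have : W i j = ∑ k, U i k * (hA.eigenvalues k - E)⁻¹ * star U k j := by
        rw [hW, Matrix.mul_apply]
        simp only [Matrix.mul_diagonal]
      rw [this]
      refine (Finset.abs_sum_le_sum_abs _ _).trans ?_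
      calc ∑ k, |U i k * (hA.eigenvalues k - E)⁻¹ * star U k j| ≤ ∑ _k : ι, δ⁻¹ := by
            refine Finset.sum_le_sum fun k _ => ?_
            have h1 : |U i k| ≤ 1 := entry_norm_bound_of_unitary hA.eigenvectorUnitary.2 i k
            have h2 : |star U k j| ≤ 1 := entry_norm_bound_of_unitary
              (star hA.eigenvectorUnitary).2 k j
            have h3 : |(hA.eigenvalues k - E)⁻¹| ≤ δ⁻¹ := by
              rw [abs_inv]
              exact inv_anti₀ hδ (h k)
            rw [abs_mul, abs_mul]
            calc |U i k| * |(hA.eigenvalues k - E)⁻¹| * |star U k j| ≤ 1 * δ⁻¹ * 1 := by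
                  gcongr
              _ = δ⁻¹ := by ring
        _ = (Fintype.card ι : ℝ) / δ := by simp [div_eq_mul_inv]
    calc entrySum W ≤ ∑ _i : ι, ∑ _j : ι, (Fintype.card ι : ℝ) / δ :=
          Finset.sum_le_sum fun i _ => Finset.sum_le_sum fun j _ => hentry i j
      _ = (Fintype.card ι : ℝ) ^ 3 / δ := by
          simp only [Finset.sum_const, Finset.card_univ, nsmul_eq_mul]
          ring

theorem card_Icc_ceil_floor_le {r : ℝ} (hr : 0 ≤ r) (c : ℝ) :
    ((Finset.Icc ⌈c - r⌉ ⌊c + r⌋).card : ℝ) ≤ 2 * r + 1 := by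
  rw [Int.card_Icc]
  have h1 := Int.floor_le (c + r)
  have h2 := Int.le_ceil (c - r)
  rcases le_total 0 (⌊c + r⌋ + 1 - ⌈c - r⌉) with h | h
  · have : ((⌊c + r⌋ + 1 - ⌈c - r⌉).toNat : ℝ) = ((⌊c + r⌋ + 1 - ⌈c - r⌉ : ℤ) : ℝ) := by
      exact_mod_cast congrArg (Int.cast (R := ℝ)) (Int.toNat_of_nonneg h)
    rw [this]
    push_cast
    linarith
  · rw [Int.toNat_of_nonpos h]
    push_cast
    linarith

/-- A grid of integers lying within `r` of one of finitely many centres is small. -/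
theorem exists_finset_int_near {α : Type*} (S : Finset α) (c : α → ℝ) {r : ℝ} (hr : 0 ≤ r) :
    ∃ F : Finset ℤ, (F.card : ℝ) ≤ S.card * (2 * r + 1) ∧
      ∀ k : ℤ, (∃ a ∈ S, |(k : ℝ) - c a| ≤ r) → k ∈ F := by
  classical
  refine ⟨S.biUnion fun a => Finset.Icc ⌈c a - r⌉ ⌊c a + r⌋, ?_, ?_⟩
  · calc ((S.biUnion fun a => Finset.Icc ⌈c a - r⌉ ⌊c a + r⌋).card : ℝ)
        ≤ ∑ a ∈ S, ((Finset.Icc ⌈c a - r⌉ ⌊c a + r⌋).card : ℝ) := by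
          exact_mod_cast Finset.card_biUnion_le
      _ ≤ ∑ _a ∈ S, (2 * r + 1) := Finset.sum_le_sum fun a _ => card_Icc_ceil_floor_le hr _
      _ = S.card * (2 * r + 1) := by rw [Finset.sum_const, nsmul_eq_mul]
  · rintro k ⟨a, ha, hk⟩
    have := abs_le.1 hk
    exact Finset.mem_biUnion.2 ⟨a, ha, Finset.mem_Icc.2
      ⟨Int.ceil_le.2 (by linarith), Int.le_floor.2 (by linarith)⟩⟩

/-- A large resolvent forces `kε` to lie near an eigenvalue, and there are at most `n` of these. The
count depends neither on `A` nor on `ε`, so it holds for every realization of the potential. -/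
theorem exists_finset_resonant {A : Matrix ι ι ℝ} (hA : A.IsHermitian) {ε : ℝ} (hε : 0 < ε) :
    ∃ F : Finset ℤ, (F.card : ℝ) ≤ 17 * (Fintype.card ι : ℝ) ^ 4 ∧
      ∀ k : ℤ, ((A - (k * ε : ℝ) • (1 : Matrix ι ι ℝ)).det = 0 ∨
        1 / (4 * ε) < entrySum (A - (k * ε : ℝ) • (1 : Matrix ι ι ℝ))⁻¹) → k ∈ F := by
  set n : ℝ := (Fintype.card ι : ℝ) with hn
  have hn0 : 0 ≤ n := Nat.cast_nonneg _
  -- Beyond distance `4 (n³ + 1) ε` from the spectrum the entry sum is at most `n³ / (4 (n³ + 1)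
  -- ε)`, hence at most `1 / (4ε)`. The `+ 1` keeps the distance positive for `n = 0`.
  obtain ⟨F, hF1, hF2⟩ := exists_finset_int_near Finset.univ (fun k => hA.eigenvalues k / ε)
    (r := 4 * (n ^ 3 + 1)) (by positivity)
  refine ⟨F, hF1.trans ?_, fun k hk => hF2 k ?_⟩
  · rw [Finset.card_univ, ← hn]
    rcases Nat.eq_zero_or_pos (Fintype.card ι) with h | h
    · simp [hn, h]
    · have h1 : 1 ≤ n := Nat.one_le_cast.2 h
      have h3 : 1 ≤ n ^ 3 := one_le_pow₀ h1
      nlinarith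
  · by_contra! hcon
    have hfar : ∀ l, 4 * (n ^ 3 + 1) * ε ≤ |hA.eigenvalues l - k * ε| := by
      intro l
      have h1 := (hcon l (Finset.mem_univ l)).le
      have h2 : |(k : ℝ) - hA.eigenvalues l / ε| * ε = |hA.eigenvalues l - k * ε| := by
        rw [abs_sub_comm, ← abs_of_pos hε, ← abs_mul, abs_of_pos hε, sub_mul,
          div_mul_cancel₀ _ hε.ne']
      rw [← h2]
      exact mul_le_mul_of_nonneg_right h1 hε.le
    obtain ⟨h1, h2⟩ := entrySum_resolvent_le hA (by positivity) hfar
    rcases hk with hk | hk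
    · exact h1 hk
    · have : n ^ 3 / (4 * (n ^ 3 + 1) * ε) ≤ 1 / (4 * ε) := by
        rw [div_le_div_iff₀ (by positivity) (by positivity)]
        nlinarith [pow_nonneg hn0 3]
      linarith

end Resonances

/-! ### The lattice Hamiltonian as a matrix -/

section Lattice

variable {d : ℕ}

/-- The max-norm distance on the lattice, as a natural number. -/
def latticeDist (x y : Zd d) : ℕ := Finset.univ.sup fun k => (x k - y k).natAbs

theorem latticeDist_le_iff {x y : Zd d} {n : ℕ} :
    latticeDist x y ≤ n ↔ ∀ k, (x k - y k).natAbs ≤ n := by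
  simp [latticeDist, Finset.sup_le_iff]

theorem norm_sub_eq_latticeDist (x y : Zd d) : ‖x - y‖ = (latticeDist x y : ℝ) := by
  have key : ∀ k, ‖(x - y) k‖ = ((x k - y k).natAbs : ℝ) := fun k => by
    rw [Pi.sub_apply, Int.norm_eq_abs, Nat.cast_natAbs, Int.cast_abs]
  refine le_antisymm ?_ ?_
  · refine (pi_norm_le_iff_of_nonneg (Nat.cast_nonneg _)).2 fun k => ?_
    rw [key]
    exact_mod_cast latticeDist_le_iff.1 le_rfl k
  · rw [← Nat.le_floor_iff (norm_nonneg _), latticeDist_le_iff]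
    intro k
    rw [Nat.le_floor_iff (norm_nonneg _), ← key]
    exact norm_le_pi_norm _ k

theorem latticeDist_self (x : Zd d) : latticeDist x x = 0 :=
  Nat.le_zero.1 (latticeDist_le_iff.2 fun k => by simp)

theorem latticeDist_comm (x y : Zd d) : latticeDist x y = latticeDist y x := by
  unfold latticeDist
  congr 1
  funext k
  omega

theorem latticeDist_triangle (x y z : Zd d) :
    latticeDist x z ≤ latticeDist x y + latticeDist y z :=
  latticeDist_le_iff.2 fun k => by
    have h1 := latticeDist_le_iff.1 (le_refl (latticeDist x y)) k
    have h2 := latticeDist_le_iff.1 (le_refl (latticeDist y z)) k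
    omega

/-- The matrix entries of `-Δ`. -/
def hopping (x y : Zd d) : ℝ := (if x = y then 2 * (d : ℝ) else 0) -
  ∑ k : Fin d, ((if y = x + Pi.single k 1 then 1 else 0) +
    (if y = x - Pi.single k 1 then 1 else 0))

theorem hopping_comm (x y : Zd d) : hopping x y = hopping y x := by
  unfold hopping
  congr 1
  · simp only [eq_comm]
  · refine Finset.sum_congr rfl fun k _ => ?_
    rw [add_comm]
    congr 1
    · exact if_congr ⟨fun h => by rw [h]; abel, fun h => by rw [h]; abel⟩ rfl rfl
    · exact if_congr ⟨fun h => by rw [h]; abel, fun h => by rw [h]; abel⟩ rfl rfl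

theorem latticeDist_le_one_of_hopping {x y : Zd d} (h : hopping x y ≠ 0) :
    latticeDist x y ≤ 1 := by
  by_contra hcon
  refine h ?_
  have hstep : ∀ (k l : Fin d), (Pi.single k 1 : Zd d) l = 0 ∨ (Pi.single k 1 : Zd d) l = 1 := by
    intro k l
    by_cases hkl : l = k
    · right; rw [hkl, Pi.single_eq_same]
    · left; rw [Pi.single_eq_of_ne hkl]
  have h0 : x ≠ y := by
    rintro rfl
    exact hcon (by rw [latticeDist_self]; exact zero_le_one)
  rw [hopping, if_neg h0, zero_sub, neg_eq_zero]
  refine Finset.sum_eq_zero fun k _ => ?_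
  rw [if_neg, if_neg, add_zero]
  · rintro rfl
    refine hcon (latticeDist_le_iff.2 fun l => ?_)
    rcases hstep k l with hl | hl <;> simp [hl]
  · rintro rfl
    refine hcon (latticeDist_le_iff.2 fun l => ?_)
    rcases hstep k l with hl | hl <;> simp [hl]

/-- Diagonal and neighbours contribute `2d` each; the extra `1` keeps the constant positive when `d
= 0`. -/
theorem sum_abs_hopping_le (S : Finset (Zd d)) (x : Zd d) :
    ∑ y ∈ S, |hopping x y| ≤ 4 * d + 1 := by
  have hite : ∀ (a : Zd d) (c : ℝ), 0 ≤ c → ∑ y ∈ S, (if y = a then c else 0) ≤ c := by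
    intro a c hc
    rw [Finset.sum_ite_eq']
    split_ifs <;> simp [hc]
  calc ∑ y ∈ S, |hopping x y|
      ≤ ∑ y ∈ S, ((if y = x then 2 * (d : ℝ) else 0) +
        ∑ k : Fin d, ((if y = x + Pi.single k 1 then 1 else 0) +
          (if y = x - Pi.single k 1 then 1 else 0))) := by
        refine Finset.sum_le_sum fun y _ => ?_
        rw [hopping]
        refine (abs_sub _ _).trans (le_of_eq ?_)
        rw [abs_of_nonneg (by split_ifs <;> positivity), abs_of_nonneg (Finset.sum_nonneg
          fun k _ => by positivity)]
        simp only [eq_comm]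
    _ = (∑ y ∈ S, if y = x then 2 * (d : ℝ) else 0) +
        ∑ k : Fin d, ((∑ y ∈ S, if y = x + Pi.single k 1 then 1 else 0) +
          ∑ y ∈ S, if y = x - Pi.single k 1 then 1 else 0) := by
        rw [Finset.sum_add_distrib, Finset.sum_comm]
        simp only [Finset.sum_add_distrib]
    _ ≤ 2 * d + ∑ _k : Fin d, ((1 : ℝ) + 1) := by
        refine add_le_add (hite _ _ (by positivity)) (Finset.sum_le_sum fun k _ => ?_)
        exact add_le_add (hite _ _ zero_le_one) (hite _ _ zero_le_one)
    _ ≤ 4 * d + 1 := by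
        rw [Finset.sum_const, Finset.card_univ, Fintype.card_fin, nsmul_eq_mul]
        linarith

/-- The entries are integers, and `|n|^s ≤ |n|` for an integer `n`. Thus the row-sum bound `4d + 1`
serves for every `s`. -/
theorem enorm_hopping_rpow_le (x y : Zd d) {s : ℝ} (hs : 0 < s) (hs1 : s ≤ 1) :
    ‖hopping x y‖ₑ ^ s ≤ ENNReal.ofReal |hopping x y| := by
  obtain ⟨n, hn⟩ : ∃ n : ℤ, hopping x y = n :=
    ⟨(if x = y then 2 * (d : ℤ) else 0) - ∑ k : Fin d,
      ((if y = x + Pi.single k 1 then 1 else 0) + (if y = x - Pi.single k 1 then 1 else 0)), by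
      simp [hopping]⟩
  rw [hn, ← ofReal_norm, Real.norm_eq_abs]
  rcases eq_or_ne n 0 with h0 | h0
  · simp [h0, hs]
  · have h1 : (1 : ℝ) ≤ |(n : ℝ)| := by exact_mod_cast Int.one_le_abs h0
    have h2 : 1 ≤ ENNReal.ofReal |(n : ℝ)| := by simpa using h1
    simpa using ENNReal.rpow_le_rpow_of_exponent_le h2 hs1

/-- The matrix of `-Δ` on a finite set. -/
def hoppingMatrix (S : Finset (Zd d)) : Matrix S S ℝ := Matrix.of fun i j => hopping i.1 j.1

/-- The matrix of `H - E` on a finite set, as a function of the potential on that set. -/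
def boxMatrix (g E : ℝ) (S : Finset (Zd d)) (w : S → ℝ) : Matrix S S ℝ :=
  cutMatrix (hoppingMatrix S) g E Finset.univ w

theorem boxMatrix_apply (g E : ℝ) (S : Finset (Zd d)) (w : S → ℝ) (i j : S) :
    boxMatrix g E S w i j = hopping i.1 j.1 + if i = j then g * w i - E else 0 := by
  simp [boxMatrix, cutMatrix, hoppingMatrix]

theorem boxMatrix_sub_smul (g E c : ℝ) (S : Finset (Zd d)) (w : S → ℝ) :
    boxMatrix g E S w - c • (1 : Matrix S S ℝ) = boxMatrix g (E + c) S w := by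
  ext i j
  rw [Matrix.sub_apply, boxMatrix_apply, boxMatrix_apply, Matrix.smul_apply, Matrix.one_apply]
  split_ifs <;> (simp; try ring)

theorem isHermitian_boxMatrix (g E : ℝ) (S : Finset (Zd d)) (w : S → ℝ) :
    (boxMatrix g E S w).IsHermitian := by
  ext i j
  rw [Matrix.conjTranspose_apply, boxMatrix_apply, boxMatrix_apply, hopping_comm]
  by_cases h : i = j
  · simp [h]
  · simp [h, Ne.symm h]

/-- `φ` is bounded by one and its restriction to `B` satisfies the real eigenvalue equation of the
Dirichlet Hamiltonian on `B`. -/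
structure IsEigenfunction (g : ℝ) (v : Zd d → ℝ) (B : Finset (Zd d)) (E : ℝ)
    (φ : Zd d → ℝ) : Prop where
  abs_le_one : ∀ x, |φ x| ≤ 1
  eq : ∀ x ∈ B, ∑ y ∈ B, hopping x y * φ y + g * v x * φ x = E * φ x

theorem dirichletHamiltonian_apply (g : ℝ) (v : Zd d → ℝ) (B : Finset (Zd d)) (ψ : B → ℂ)
    (x : B) : dirichletHamiltonian g v B ψ x =
      ∑ y : B, (hopping x.1 y.1 : ℂ) * ψ y + (g * v x : ℝ) * ψ x := by
  set ψ' : Zd d → ℂ := Function.ExtendByZero.linearMap ℂ (Subtype.val : B → Zd d) ψ with hψ'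
  have hval : ∀ y : B, ψ' y = ψ y := fun y => by
    rw [hψ', Function.ExtendByZero.linearMap_apply]
    exact Subtype.val_injective.extend_apply _ _ _
  have hout : ∀ a : Zd d, a ∉ B → ψ' a = 0 := fun a ha => by
    rw [hψ', Function.ExtendByZero.linearMap_apply, Function.extend_apply', Pi.zero_apply]
    rintro ⟨y, rfl⟩
    exact ha y.2
  have hpt : ∀ a : Zd d, ∑ y : B, ((if y.1 = a then 1 else 0 : ℝ) : ℂ) * ψ y = ψ' a := by
    intro a
    by_cases ha : a ∈ B
    · rw [Finset.sum_eq_single ⟨a, ha⟩]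
      · simp [← hval]
      · intro b _ hb
        have : b.1 ≠ a := fun h => hb (Subtype.ext h)
        simp [this]
      · simp
    · rw [hout a ha]
      refine Finset.sum_eq_zero fun y _ => ?_
      have : y.1 ≠ a := fun h => ha (h ▸ y.2)
      simp [this]
  have hH : dirichletHamiltonian g v B ψ x = hamiltonian g v ψ' x.1 := rfl
  have hsum : ∑ y : B, (hopping x.1 y.1 : ℂ) * ψ y =
      2 * d * ψ' x - ∑ k : Fin d, (ψ' (x.1 + Pi.single k 1) + ψ' (x.1 - Pi.single k 1)) := by
    calc ∑ y : B, (hopping x.1 y.1 : ℂ) * ψ y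
        = ∑ y : B, (2 * d * (((if y.1 = x.1 then 1 else 0 : ℝ) : ℂ) * ψ y) -
          ∑ k : Fin d, (((if y.1 = x.1 + Pi.single k 1 then 1 else 0 : ℝ) : ℂ) * ψ y +
            ((if y.1 = x.1 - Pi.single k 1 then 1 else 0 : ℝ) : ℂ) * ψ y)) := by
          refine Finset.sum_congr rfl fun y _ => ?_
          rw [hopping, Complex.ofReal_sub, sub_mul, Complex.ofReal_sum, Finset.sum_mul]
          congr 1
          · by_cases h : x = y
            · simp [h]
            · have h1 : x.1 ≠ y.1 := fun h' => h (Subtype.ext h')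
              simp [h1, Ne.symm h1]
          · refine Finset.sum_congr rfl fun k _ => ?_
            rw [Complex.ofReal_add, add_mul]
      _ = _ := by
          rw [Finset.sum_sub_distrib, ← Finset.mul_sum, hpt, Finset.sum_comm]
          congr 1
          refine Finset.sum_congr rfl fun k _ => ?_
          rw [Finset.sum_add_distrib, hpt, hpt]
  rw [hsum, hH, ← hval]
  simp only [hamiltonian, laplacian, potential, LinearMap.add_apply, LinearMap.neg_apply,
    LinearMap.smul_apply, LinearMap.coe_mk, AddHom.coe_mk, Pi.add_apply, Pi.neg_apply,
    Pi.smul_apply, smul_eq_mul]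
  have : ∑ k : Fin d, (ψ' (x.1 + Pi.single k 1) - ψ' x.1 + (ψ' (x.1 - Pi.single k 1) - ψ' x.1)) =
      ∑ k : Fin d, (ψ' (x.1 + Pi.single k 1) + ψ' (x.1 - Pi.single k 1)) - 2 * d * ψ' x.1 := by
    rw [eq_sub_iff_add_eq]
    have : 2 * d * ψ' x.1 = ∑ _k : Fin d, 2 * ψ' x.1 := by
      simp
      ring
    rw [this, ← Finset.sum_add_distrib]
    exact Finset.sum_congr rfl fun k _ => by ring
  rw [this]
  push_cast
  ring

/-- The eigenvalues of the Dirichlet Hamiltonian are real. -/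
theorem eigenvalue_im_eq_zero {g : ℝ} {v : Zd d → ℝ} {B : Finset (Zd d)} {E : ℂ} {ψ : B → ℂ}
    (h : (dirichletHamiltonian g v B).HasEigenvector E ψ) : E.im = 0 := by
  obtain ⟨y, hy⟩ := Function.ne_iff.1 h.2
  have heq : ∀ x : B, ∑ y : B, (hopping x.1 y.1 : ℂ) * ψ y + (g * v x : ℝ) * ψ x = E * ψ x :=
    fun x => by
      rw [← dirichletHamiltonian_apply, h.apply_eq_smul, Pi.smul_apply, smul_eq_mul]
  have h1 : ∑ x : B, (star (ψ x) * ∑ y : B, (hopping x.1 y.1 : ℂ) * ψ y) +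
      ∑ x : B, (g * v x : ℝ) * (star (ψ x) * ψ x) = E * ∑ x : B, star (ψ x) * ψ x := by
    rw [Finset.mul_sum, ← Finset.sum_add_distrib]
    refine Finset.sum_congr rfl fun x _ => ?_
    linear_combination star (ψ x) * heq x
  set Q := ∑ x : B, (star (ψ x) * ∑ y : B, (hopping x.1 y.1 : ℂ) * ψ y) with hQ
  have hQ' : star Q = Q := by
    simp only [hQ, star_sum, star_mul', star_star, Finset.mul_sum]
    rw [Finset.sum_comm]
    refine Finset.sum_congr rfl fun x _ => Finset.sum_congr rfl fun y _ => ?_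
    rw [hopping_comm y.1 x.1, Complex.star_def, Complex.conj_ofReal]
    ring
  have hnn : ∀ x : B, star (ψ x) * ψ x = ((‖ψ x‖ ^ 2 : ℝ) : ℂ) := fun x => by
    rw [Complex.star_def, Complex.conj_mul']
    push_cast
    rfl
  simp only [hnn] at h1
  have him := congrArg Complex.im h1
  have hQim : Q.im = 0 := Complex.conj_eq_iff_im.1 hQ'
  have hn : ∑ x : B, ((‖ψ x‖ ^ 2 : ℝ) : ℂ) = ((∑ x : B, ‖ψ x‖ ^ 2 : ℝ) : ℂ) := by
    push_cast
    rfl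
  have hp : ∑ x : B, ((g * v x : ℝ) : ℂ) * ((‖ψ x‖ ^ 2 : ℝ) : ℂ) =
      ((∑ x : B, g * v x * ‖ψ x‖ ^ 2 : ℝ) : ℂ) := by
    push_cast
    rfl
  rw [hn, hp, Complex.add_im, hQim, Complex.ofReal_im, Complex.im_mul_ofReal, add_zero] at him
  have hpos : 0 < ∑ x : B, ‖ψ x‖ ^ 2 :=
    Finset.sum_pos' (fun _ _ => by positivity) ⟨y, Finset.mem_univ y, by
      have := norm_pos_iff.2 hy
      positivity⟩
  exact (mul_eq_zero.1 him.symm).resolve_right hpos.ne'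

/-- A linear functional commuting with real scalars maps normalized eigenvectors to bounded real
eigenfunctions. -/
theorem isEigenfunction_of_hasEigenvector {g : ℝ} {v : Zd d → ℝ} {B : Finset (Zd d)} {E : ℂ}
    {ψ : B → ℂ} (h : (dirichletHamiltonian g v B).HasEigenvector E ψ)
    (hψ : ∑ x, ‖ψ x‖ ^ 2 = 1) (f : ℂ →ₗ[ℝ] ℝ) (hf : ∀ z, |f z| ≤ ‖z‖) :
    IsEigenfunction g v B E.re (fun x => if hx : x ∈ B then f (ψ ⟨x, hx⟩) else 0) where
  abs_le_one x := by
    split_ifs with hx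
    · refine (hf _).trans ?_
      have : ‖ψ ⟨x, hx⟩‖ ^ 2 ≤ 1 := by
        rw [← hψ]
        exact Finset.single_le_sum (f := fun x => ‖ψ x‖ ^ 2) (fun _ _ => by positivity)
          (Finset.mem_univ _)
      exact (sq_le_one_iff₀ (norm_nonneg _)).1 this
    · simp
  eq x hx := by
    have hE : E = (E.re : ℂ) := Complex.ext rfl (by simp [eigenvalue_im_eq_zero h])
    have h1 : ∑ y : B, (hopping x y.1 : ℂ) * ψ y + (g * v x : ℝ) * ψ ⟨x, hx⟩ =
        (E.re : ℂ) * ψ ⟨x, hx⟩ := by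
      rw [← hE]
      have := dirichletHamiltonian_apply g v B ψ ⟨x, hx⟩
      rw [h.apply_eq_smul, Pi.smul_apply, smul_eq_mul] at this
      exact this.symm
    have h2 := congrArg f h1
    simp only [← Complex.real_smul, map_add, map_sum, map_smul, smul_eq_mul] at h2
    rw [dif_pos hx, ← h2, ← Finset.sum_coe_sort B]
    simp

/-- The pairs `(x, z)` with `z` at distance at least `r` from `x`. -/
def edgePairs {S : Finset (Zd d)} (x : S) (r : ℕ) : Finset (S × S) :=
  {x} ×ˢ Finset.univ.filter fun z => r ≤ latticeDist x.1 z.1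

theorem card_edgePairs_le {S : Finset (Zd d)} (x : S) (r : ℕ) : (edgePairs x r).card ≤ S.card := by
  rw [edgePairs, Finset.card_product, Finset.card_singleton, one_mul]
  exact (Finset.card_le_univ _).trans (Fintype.card_coe S).le

/-- On `S` the function solves `(H_S - E) φ = f`, where `f` comes from bonds leaving `S` inside `B`.
Such bonds start at distance at least `r` from `x`, so only the far entries of the Green function
contribute. -/
theorem IsEigenfunction.abs_le_edge_sum {g : ℝ} {v : Zd d → ℝ} {B : Finset (Zd d)} {E : ℝ}
    {φ : Zd d → ℝ} (h : IsEigenfunction g v B E φ) {S : Finset (Zd d)} (hS : S ⊆ B) {r : ℕ}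
    {x : S} (hr : ∀ z ∈ B, latticeDist x.1 z ≤ r → z ∈ S)
    (hdet : (boxMatrix g E S fun z => v z).det ≠ 0) :
    |φ x| ≤ (4 * d + 1) * ∑ p ∈ edgePairs x r,
      |(boxMatrix g E S fun z => v z)⁻¹ p.1 p.2| := by
  rw [edgePairs, Finset.sum_product, Finset.sum_singleton, Finset.sum_filter]
  set M := boxMatrix g E S fun z => v z with hM
  have hMφ : ∀ z : S, M.mulVec (fun y : S => φ y) z = -∑ y ∈ B \ S, hopping z.1 y * φ y := by
    intro z
    have h1 := h.eq z.1 (hS z.2)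
    rw [← Finset.sum_sdiff hS] at h1
    rw [Matrix.mulVec, dotProduct]
    simp only [hM, boxMatrix_apply, add_mul, ite_mul, zero_mul, Finset.sum_add_distrib,
      Finset.sum_ite_eq, Finset.mem_univ, if_true]
    rw [Finset.sum_coe_sort S fun y => hopping z.1 y * φ y]
    linarith
  have hφ : φ x = ∑ z : S, M⁻¹ x z * M.mulVec (fun y : S => φ y) z := by
    have : M⁻¹.mulVec (M.mulVec fun y : S => φ y) = fun y : S => φ y := by
      rw [Matrix.mulVec_mulVec, Matrix.nonsing_inv_mul _ (isUnit_iff_ne_zero.2 hdet),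
        Matrix.one_mulVec]
    exact (congrFun this x).symm
  rw [hφ, Finset.mul_sum]
  refine (Finset.abs_sum_le_sum_abs _ _).trans (Finset.sum_le_sum fun z _ => ?_)
  rw [abs_mul, hMφ, abs_neg]
  split_ifs with hz
  · rw [mul_comm]
    refine mul_le_mul_of_nonneg_right ?_ (abs_nonneg _)
    refine (Finset.abs_sum_le_sum_abs _ _).trans
      ((Finset.sum_le_sum fun y _ => ?_).trans (sum_abs_hopping_le (B \ S) z.1))
    rw [abs_mul]
    exact mul_le_of_le_one_right (abs_nonneg _) (h.abs_le_one y)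
  · have : ∑ y ∈ B \ S, hopping z.1 y * φ y = 0 := by
      refine Finset.sum_eq_zero fun y hy => ?_
      obtain ⟨hyB, hyS⟩ := Finset.mem_sdiff.1 hy
      by_cases hzy : hopping z.1 y = 0
      · rw [hzy, zero_mul]
      · refine absurd (hr y hyB ?_) hyS
        have h1 := latticeDist_le_one_of_hopping hzy
        have h2 := latticeDist_triangle x.1 z.1 y
        omega
    rw [this, abs_zero, mul_zero, mul_zero]

/-- Each use of the eigenvalue equation gains `(4d + 1) / K` and moves by one site, which can be
repeated `r + 1` times starting from `x`. -/
theorem IsEigenfunction.abs_le_of_far {g : ℝ} {v : Zd d → ℝ} {B : Finset (Zd d)} {E : ℝ}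
    {φ : Zd d → ℝ} (h : IsEigenfunction g v B E φ) {x : Zd d} {r : ℕ} {K : ℝ} (hK : 0 < K)
    (hfar : ∀ w ∈ B, latticeDist x w ≤ r → K < |E - g * v w|) (n : ℕ) :
    ∀ w ∈ B, latticeDist x w + n ≤ r + 1 → |φ w| ≤ ((4 * d + 1) / K) ^ n := by
  induction n with
  | zero => intro w _ _; simpa using h.abs_le_one w
  | succ n ih =>
    intro w hw hwr
    have h1 : (E - g * v w) * φ w = ∑ y ∈ B, hopping w y * φ y := by
      have := h.eq w hw
      linarith
    have h2 : K * |φ w| ≤ (4 * d + 1) * ((4 * d + 1) / K) ^ n := by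
      calc K * |φ w| ≤ |E - g * v w| * |φ w| :=
            mul_le_mul_of_nonneg_right (hfar w hw (by omega)).le (abs_nonneg _)
        _ = |∑ y ∈ B, hopping w y * φ y| := by rw [← abs_mul, h1]
        _ ≤ ∑ y ∈ B, |hopping w y| * ((4 * d + 1) / K) ^ n := by
            refine (Finset.abs_sum_le_sum_abs _ _).trans (Finset.sum_le_sum fun y hy => ?_)
            rw [abs_mul]
            by_cases hwy : hopping w y = 0
            · simp [hwy]
            · refine mul_le_mul_of_nonneg_left (ih y hy ?_) (abs_nonneg _)
              have h1 := latticeDist_le_one_of_hopping hwy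
              have h2 := latticeDist_triangle x w y
              omega
        _ ≤ _ := by
            rw [← Finset.sum_mul]
            exact mul_le_mul_of_nonneg_right (sum_abs_hopping_le B w) (by positivity)
    rw [pow_succ', div_mul_eq_mul_div, le_div_iff₀ hK]
    linarith

end Lattice

/-! ### Resonances at fixed energies -/

section FixedEnergy

/-- A union bound over integers, for events that are products of two independent events of which
the first occurs for few integers only. -/
theorem measure_exists_int_le {Ω α β : Type*} [MeasurableSpace Ω] [MeasurableSpace α]
    [MeasurableSpace β] {P : Measure Ω} [IsProbabilityMeasure P] {X : Ω → α} {Y : Ω → β}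
    (hX : Measurable X) (hXY : IndepFun X Y P) {A : ℤ → Set α} {B : ℤ → Set β}
    (hA : ∀ i, MeasurableSet (A i)) (hB : ∀ i, MeasurableSet (B i)) {N δ : ℝ} (hN0 : 0 ≤ N)
    (hN : ∀ a, ∃ F : Finset ℤ, (F.card : ℝ) ≤ N ∧ ∀ i, a ∈ A i → i ∈ F)
    (hδ : ∀ i, P (Y ⁻¹' B i) ≤ ENNReal.ofReal δ) :
    P {ω | ∃ i, X ω ∈ A i ∧ Y ω ∈ B i} ≤ ENNReal.ofReal (N * δ) := by
  have hset : {ω | ∃ i, X ω ∈ A i ∧ Y ω ∈ B i} = ⋃ i, (X ⁻¹' A i ∩ Y ⁻¹' B i) := by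
    ext ω
    simp
  -- The expected number of indices selected by `X` is at most `N`; this replaces a union bound over
  -- infinitely many integers.
  have hcount : ∑' i, P (X ⁻¹' A i) ≤ ENNReal.ofReal N := by
    calc ∑' i, P (X ⁻¹' A i) = ∑' i, ∫⁻ ω, (X ⁻¹' A i).indicator 1 ω ∂P := by
          simp_rw [lintegral_indicator_one (hX (hA _))]
      _ = ∫⁻ ω, ∑' i, (X ⁻¹' A i).indicator 1 ω ∂P :=
          (lintegral_tsum fun i => (measurable_one.indicator (hX (hA i))).aemeasurable).symm
      _ ≤ ∫⁻ _, ENNReal.ofReal N ∂P := by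
          refine lintegral_mono fun ω => ?_
          obtain ⟨F, hF, hF'⟩ := hN (X ω)
          have hout : ∀ i ∉ F, (X ⁻¹' A i).indicator (1 : Ω → ℝ≥0∞) ω = 0 := fun i hi =>
            Set.indicator_of_notMem (s := X ⁻¹' A i) (fun h => hi (hF' i h)) _
          rw [tsum_eq_sum fun i hi => hout i hi]
          calc ∑ i ∈ F, (X ⁻¹' A i).indicator (1 : Ω → ℝ≥0∞) ω ≤ ∑ _i ∈ F, 1 :=
                Finset.sum_le_sum fun i _ => Set.indicator_le_self' (by simp) _
            _ = ENNReal.ofReal F.card := by simp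
            _ ≤ ENNReal.ofReal N := ENNReal.ofReal_le_ofReal hF
      _ = ENNReal.ofReal N := by simp
  calc P {ω | ∃ i, X ω ∈ A i ∧ Y ω ∈ B i} ≤ ∑' i, P (X ⁻¹' A i ∩ Y ⁻¹' B i) := by
        rw [hset]
        exact measure_iUnion_le _
    _ ≤ ∑' i, P (X ⁻¹' A i) * ENNReal.ofReal δ := by
        refine ENNReal.tsum_le_tsum fun i => ?_
        rw [hXY.measure_inter_preimage_eq_mul _ _ (hA i) (hB i)]
        gcongr
        exact hδ i
    _ ≤ ENNReal.ofReal (N * δ) := by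
        rw [ENNReal.tsum_mul_right, ENNReal.ofReal_mul hN0]
        gcongr

variable {d : ℕ}

/-- The potentials on `S` for which `E` is an eigenvalue, or the Green function at energy `E`
summed over the pairs in `J` exceeds `b`. -/
def greenLarge (g E : ℝ) (S : Finset (Zd d)) (J : Finset (S × S)) (b : ℝ) : Set (S → ℝ) :=
  {w | (boxMatrix g E S w).det = 0 ∨ b < ∑ p ∈ J, |(boxMatrix g E S w)⁻¹ p.1 p.2|}

theorem measurable_det_boxMatrix (g E : ℝ) (S : Finset (Zd d)) :
    Measurable fun w => (boxMatrix g E S w).det :=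
  measurable_det_cutMatrix (hoppingMatrix S) g E Finset.univ

theorem measurable_inv_boxMatrix (g E : ℝ) (S : Finset (Zd d)) (i j : S) :
    Measurable fun w => (boxMatrix g E S w)⁻¹ i j :=
  measurable_inv_cutMatrix (hoppingMatrix S) g E Finset.univ i j

theorem measurableSet_greenLarge (g E : ℝ) (S : Finset (Zd d)) (J : Finset (S × S)) (b : ℝ) :
    MeasurableSet (greenLarge g E S J b) := by
  have hm : Measurable fun w => ∑ p ∈ J, |(boxMatrix g E S w)⁻¹ p.1 p.2| :=
    Finset.measurable_fun_sum J fun p _ => (measurable_inv_boxMatrix g E S p.1 p.2).abs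
  exact (measurableSet_eq_fun (measurable_det_boxMatrix g E S) measurable_const).union
    (measurableSet_lt measurable_const hm)

theorem notMem_greenLarge_iff {g E : ℝ} {S : Finset (Zd d)} {J : Finset (S × S)} {b : ℝ}
    {w : S → ℝ} : w ∉ greenLarge g E S J b ↔ (boxMatrix g E S w).det ≠ 0 ∧
      ∑ p ∈ J, |(boxMatrix g E S w)⁻¹ p.1 p.2| ≤ b := by
  rw [greenLarge, Set.mem_ofPred_eq, not_or, not_lt]

theorem sum_univ_abs_eq_entrySum {S : Finset (Zd d)} (G : Matrix S S ℝ) :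
    ∑ p : S × S, |G p.1 p.2| = entrySum G :=
  Fintype.sum_prod_type _

/-- Passage from a grid energy to any energy within `c`: a total bound `b` on the Green function
limits the change of a partial sum to `2cb²`. -/
theorem notMem_greenLarge_of_near {g E E' : ℝ} {S : Finset (Zd d)} {w : S → ℝ} {b c : ℝ}
    (hb : w ∉ greenLarge g E S Finset.univ b) (hc : |E' - E| ≤ c) (hcb : c * b ≤ 1 / 2) :
    w ∉ greenLarge g E' S Finset.univ (2 * b) ∧ ∀ (J : Finset (S × S)) (a : ℝ),
      w ∉ greenLarge g E S J a → w ∉ greenLarge g E' S J (a + 2 * c * b ^ 2) := by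
  rw [notMem_greenLarge_iff, sum_univ_abs_eq_entrySum] at hb
  have hN := entrySum_nonneg (boxMatrix g E S w)⁻¹
  have hsmall : |E' - E| * entrySum (boxMatrix g E S w)⁻¹ ≤ 1 / 2 :=
    (mul_le_mul hc hb.2 hN ((abs_nonneg _).trans hc)).trans hcb
  obtain ⟨h1, h2, h3⟩ := resolvent_perturbation hb.1 hsmall
  rw [boxMatrix_sub_smul, add_sub_cancel] at h1 h2 h3
  refine ⟨?_, fun J a ha => ?_⟩
  · rw [notMem_greenLarge_iff, sum_univ_abs_eq_entrySum]
    exact ⟨h1, h2.trans (mul_le_mul_of_nonneg_left hb.2 zero_le_two)⟩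
  · rw [notMem_greenLarge_iff] at ha ⊢
    refine ⟨h1, ?_⟩
    set G := (boxMatrix g E S w)⁻¹
    set G' := (boxMatrix g E' S w)⁻¹
    calc ∑ p ∈ J, |G' p.1 p.2| ≤ ∑ p ∈ J, (|G p.1 p.2| + |(G' - G) p.1 p.2|) := by
          refine Finset.sum_le_sum fun p _ => ?_
          have := abs_add_le (G p.1 p.2) (G' p.1 p.2 - G p.1 p.2)
          rwa [add_sub_cancel] at this
      _ ≤ a + entrySum (G' - G) := by
          rw [Finset.sum_add_distrib, ← sum_univ_abs_eq_entrySum]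
          exact add_le_add ha.2 (Finset.sum_le_univ_sum_of_nonneg fun _ => abs_nonneg _)
      _ ≤ a + 2 * c * b ^ 2 := by
          refine add_le_add le_rfl (h3.trans ?_)
          have hb0 : 0 ≤ b := hN.trans hb.2
          have := (abs_nonneg _).trans hc
          gcongr
          exact hb.2

/-- Unless one of countably many resonances occurs, the eigenfunctions with energy `E` are all
small at `x` or all small at `y`. -/
theorem abs_eigenfunction_le_or {g : ℝ} {v : Zd d → ℝ} {B Sx Sy : Finset (Zd d)} (hSx : Sx ⊆ B)
    (hSy : Sy ⊆ B) {r : ℕ} {x : Sx} {y : Sy} (hrx : ∀ z ∈ B, latticeDist x.1 z ≤ r → z ∈ Sx)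
    (hry : ∀ z ∈ B, latticeDist y.1 z ≤ r → z ∈ Sy) {t K : ℝ} (ht0 : 0 < t) (ht1 : t ≤ 1 / 2)
    (hK : 0 < K) (hKt : ((4 * d + 1) / K) ^ (r + 1) ≤ t)
    (h1 : ¬ ∃ i : ℤ, (∃ z : Sx, |i * t ^ 7 - g * v z| ≤ K + 1) ∧
      (fun z : Sy => v z) ∈ greenLarge g (i * t ^ 7) Sy (edgePairs y r) t)
    (h2 : ¬ ∃ k : ℤ,
      (fun z : Sy => v z) ∈ greenLarge g (k * t ^ 3) Sy Finset.univ (1 / (4 * t ^ 3)) ∧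
      (fun z : Sx => v z) ∈ greenLarge g (k * t ^ 3) Sx (edgePairs x r) t ∪
        greenLarge g (k * t ^ 3) Sx Finset.univ (1 / t)) (E : ℝ) :
    (∀ φ, IsEigenfunction g v B E φ → |φ x| ≤ 3 * (4 * d + 1) * t) ∨
      ∀ φ, IsEigenfunction g v B E φ → |φ y| ≤ 3 * (4 * d + 1) * t := by
  have hd : (0 : ℝ) ≤ d := Nat.cast_nonneg d
  have hgrid : ∀ η : ℝ, 0 < η → |E - ⌊E / η⌋ * η| ≤ η := by
    intro η hη
    have e1 := Int.floor_le (E / η)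
    have e2 := Int.lt_floor_add_one (E / η)
    rw [le_div_iff₀ hη] at e1
    rw [div_lt_iff₀ hη] at e2
    rw [abs_le]
    constructor <;> linarith
  have ht2 : t ^ 2 ≤ 1 / 4 := by nlinarith
  have ht3 : t ^ 3 ≤ 1 / 8 := by nlinarith
  have ht4 : t ^ 4 ≤ 1 / 2 := by nlinarith
  have ht73 : t ^ 7 ≤ t ^ 3 := pow_le_pow_of_le_one ht0.le (by linarith) (by norm_num)
  -- First alternative: no site near `x` has `g v` within `K` of `E`, and `φ x` is small
  -- deterministically.
  by_cases hfar : ∀ w ∈ B, latticeDist x.1 w ≤ r → K < |E - g * v w|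
  · refine Or.inl fun φ hφ => ((hφ.abs_le_of_far hK hfar (r + 1) x.1 (hSx x.2)
      (by rw [latticeDist_self, zero_add])).trans hKt).trans ?_
    nlinarith
  push Not at hfar
  obtain ⟨w, hwB, hwr, hwK⟩ := hfar
  have hi := hgrid (t ^ 7) (by positivity)
  set i := ⌊E / t ^ 7⌋
  have hy : (fun z : Sy => v z) ∉ greenLarge g (i * t ^ 7) Sy (edgePairs y r) t := by
    refine fun hmem => h1 ⟨i, ⟨⟨w, hrx w hwB hwr⟩, ?_⟩, hmem⟩
    rw [abs_sub_comm] at hi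
    have := abs_sub_le (i * t ^ 7) E (g * v w)
    dsimp only
    linarith
  have hlast : ∀ D : ℝ, D ≤ 3 * t → (4 * d + 1) * D ≤ 3 * (4 * d + 1) * t := fun D hD => by
    nlinarith
  -- If the total on `Sy` is at most `t^{-3}`, moving by `t^7` costs `2 t^7 t^{-6} = 2t`. Otherwise
  -- `E` is resonant for `Sy`, and `Sx` is used with step `t^3` and total `t^{-1}`, again at cost
  -- `2t`.
  by_cases hN : (fun z : Sy => v z) ∈ greenLarge g (i * t ^ 7) Sy Finset.univ (1 / t ^ 3)
  · left
    have hk := hgrid (t ^ 3) (by positivity)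
    set k := ⌊E / t ^ 3⌋
    have hky : (fun z : Sy => v z) ∈
        greenLarge g (k * t ^ 3) Sy Finset.univ (1 / (4 * t ^ 3)) := by
      -- The threshold `1 / (4t³)` fits the distance `2t³` between the two grid points: their
      -- product is `1/2`, so a smaller total at `k t³` would at most double and contradict `hN`.
      by_contra hcon
      have hik : |(i : ℝ) * t ^ 7 - k * t ^ 3| ≤ 2 * t ^ 3 := by
        rw [abs_sub_comm] at hi
        have := abs_sub_le (i * t ^ 7) E (k * t ^ 3)
        linarith
      have h3 := (notMem_greenLarge_of_near hcon hik
        (le_of_eq (by field_simp; norm_num))).1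
      rw [notMem_greenLarge_iff] at h3
      refine notMem_greenLarge_iff.2 ⟨h3.1, h3.2.trans ?_⟩ hN
      have : 2 * (1 / (4 * t ^ 3)) = 1 / t ^ 3 / 2 := by field_simp; norm_num
      rw [this]
      exact half_le_self (by positivity)
    have hx : (fun z : Sx => v z) ∉ greenLarge g (k * t ^ 3) Sx (edgePairs x r) t ∪
        greenLarge g (k * t ^ 3) Sx Finset.univ (1 / t) := fun h => h2 ⟨k, hky, h⟩
    rw [Set.mem_union, not_or] at hx
    have h3 := (notMem_greenLarge_of_near hx.2 hk
      (by rw [mul_one_div, pow_succ, mul_div_cancel_right₀ _ ht0.ne']; linarith)).2 _ _ hx.1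
    rw [notMem_greenLarge_iff] at h3
    refine fun φ hφ => (hφ.abs_le_edge_sum hSx hrx h3.1).trans (hlast _ (h3.2.trans ?_))
    refine le_of_eq ?_
    field_simp
    ring
  · right
    have h3 := (notMem_greenLarge_of_near hN hi (by
      have : t ^ 7 * (1 / t ^ 3) = t ^ 4 := by field_simp
      rw [this]; exact ht4)).2 _ _ hy
    rw [notMem_greenLarge_iff] at h3
    refine fun φ hφ => (hφ.abs_le_edge_sum hSy hry h3.1).trans (hlast _ (h3.2.trans ?_))
    refine le_of_eq ?_
    field_simp
    ring

/-! ### Probability of resonances -/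

section Probability

variable {Ω : Type*} [MeasurableSpace Ω] {P : Measure Ω} [IsProbabilityMeasure P]
  {V : Zd d → Ω → ℝ}

theorem map_potential_eq_pi (hmeas : ∀ x, Measurable (V x)) (hindep : iIndepFun V P)
    (hident : ∀ x, IdentDistrib (V x) (V 0) P P) (S : Finset (Zd d)) :
    P.map (fun ω (z : S) => V z ω) = Measure.pi fun _ : S => P.map (V 0) := by
  rw [(iIndepFun_iff_map_fun_eq_pi_map fun z : S => (hmeas z).aemeasurable).1
    (hindep.precomp Subtype.val_injective)]
  congr 1
  funext z
  exact (hident z).map_eq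

variable {g s q : ℝ}

/-- Chebyshev's inequality for the `s`-th moment, which is subadditive over `J`. The set where the
determinant vanishes is null, so it costs nothing. -/
theorem measure_greenLarge_le (hmeas : ∀ x, Measurable (V x)) (hindep : iIndepFun V P)
    (hident : ∀ x, IdentDistrib (V x) (V 0) P P) (hs : 0 < s) (hs1 : s ≤ 1)
    (hatom : ∀ a, P.map (V 0) {t | g * t = a} = 0) (hq0 : 0 ≤ q) (hq : q ≤ 1)
    (hA : ∀ a, ∫⁻ t, ‖(g * t - a)⁻¹‖ₑ ^ s ∂(P.map (V 0)) ≤ ENNReal.ofReal (q / (4 * d + 1)))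
    (E : ℝ) (S : Finset (Zd d)) (J : Finset (S × S)) {b M : ℝ} (hb : 0 < b)
    (hM : ∀ p ∈ J, q ^ latticeDist p.1.1 p.2.1 ≤ M) :
    P ((fun ω (z : S) => V z ω) ⁻¹' greenLarge g E S J b) ≤
      ENNReal.ofReal (b⁻¹ ^ s * (J.card * M)) := by
  have hprob : IsProbabilityMeasure (P.map (V 0)) :=
    Measure.isProbabilityMeasure_map (hmeas 0).aemeasurable
  rw [← Measure.map_apply (measurable_pi_lambda _ fun z : S => hmeas z)
    (measurableSet_greenLarge _ _ _ _ _), map_potential_eq_pi hmeas hindep hident]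
  set ν := Measure.pi fun _ : S => P.map (V 0)
  set f : (S → ℝ) → ℝ≥0∞ := fun w => ∑ p ∈ J, ‖(boxMatrix g E S w)⁻¹ p.1 p.2‖ₑ ^ s with hf
  have hfm : ∀ p : S × S, Measurable fun w => ‖(boxMatrix g E S w)⁻¹ p.1 p.2‖ₑ ^ s := fun p =>
    (measurable_inv_boxMatrix g E S p.1 p.2).enorm.pow_const s
  have hint : ∫⁻ w, f w ∂ν ≤ ENNReal.ofReal (J.card * M) := by
    rw [hf, lintegral_finsetSum _ fun p _ => hfm p]
    calc ∑ p ∈ J, ∫⁻ w, ‖(boxMatrix g E S w)⁻¹ p.1 p.2‖ₑ ^ s ∂ν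
        ≤ ∑ _p ∈ J, ENNReal.ofReal M := by
          refine Finset.sum_le_sum fun p hp => ?_
          refine (lintegral_inv_cutMatrix_rpow_le (D := 4 * d + 1) hs hs1 hatom hA
            (by positivity) ?_ (by positivity) (le_of_eq (by field_simp)) hq ?_
            (n := fun i j : S => latticeDist i.1 j.1) (fun i => latticeDist_self _) ?_ E
            Finset.univ (Finset.mem_univ p.1) (Finset.mem_univ p.2)).trans
            (ENNReal.ofReal_le_ofReal (hM p hp))
          · exact (div_le_self hq0 (by linarith [(Nat.cast_nonneg d : (0 : ℝ) ≤ d)])).trans hq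
          · intro i
            calc ∑ k : S, ‖hoppingMatrix S i k‖ₑ ^ s
                ≤ ∑ k : S, ENNReal.ofReal |hopping i.1 k.1| :=
                  Finset.sum_le_sum fun k _ => enorm_hopping_rpow_le _ _ hs hs1
              _ = ENNReal.ofReal (∑ k ∈ S, |hopping i.1 k|) := by
                  rw [← ENNReal.ofReal_sum_of_nonneg fun _ _ => abs_nonneg _,
                    Finset.sum_coe_sort S fun k => |hopping i.1 k|]
              _ ≤ _ := ENNReal.ofReal_le_ofReal (sum_abs_hopping_le S i.1)
          · intro i j k hik
            have h1 := latticeDist_le_one_of_hopping hik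
            have h2 := latticeDist_triangle i.1 k.1 j.1
            omega
      _ = ENNReal.ofReal (J.card * M) := by
          rw [Finset.sum_const, nsmul_eq_mul, ENNReal.ofReal_mul (Nat.cast_nonneg _),
            ENNReal.ofReal_natCast]
  have hb' : ENNReal.ofReal b ≠ 0 := by simpa using hb
  have hsub : greenLarge g E S J b ≤ᵐ[ν] {w | ENNReal.ofReal b ^ s ≤ f w} := by
    filter_upwards [ae_det_cutMatrix_ne_zero hatom (hoppingMatrix S) E Finset.univ] with w hw hmem
    have hlt : b < ∑ p ∈ J, |(boxMatrix g E S w)⁻¹ p.1 p.2| := hmem.resolve_left hw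
    have h1 := enorm_sum_rpow_le J (fun p => |(boxMatrix g E S w)⁻¹ p.1 p.2|) hs hs1
    simp only [Real.enorm_abs] at h1
    refine le_trans (ENNReal.rpow_le_rpow ?_ hs.le) h1
    rw [← ofReal_norm, Real.norm_eq_abs]
    exact ENNReal.ofReal_le_ofReal (hlt.le.trans (le_abs_self _))
  calc ν (greenLarge g E S J b) ≤ ν {w | ENNReal.ofReal b ^ s ≤ f w} := measure_mono_ae hsub
    _ ≤ (∫⁻ w, f w ∂ν) / ENNReal.ofReal b ^ s :=
        meas_ge_le_lintegral_div (Finset.measurable_fun_sum _ fun p _ => hfm p).aemeasurable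
          (by rw [ENNReal.ofReal_rpow_of_pos hb]; simpa using Real.rpow_pos_of_pos hb s)
          (by rw [ENNReal.ofReal_rpow_of_pos hb]; exact ENNReal.ofReal_ne_top)
    _ ≤ ENNReal.ofReal (b⁻¹ ^ s * (J.card * M)) := by
        rw [ENNReal.ofReal_rpow_of_pos hb, ENNReal.div_eq_inv_mul,
          ← ENNReal.ofReal_inv_of_pos (Real.rpow_pos_of_pos hb s), Real.inv_rpow hb.le,
          ENNReal.ofReal_mul (by positivity)]
        gcongr

/-- With high probability, no eigenfunction charges both `x` and `y`. -/
theorem measure_not_abs_eigenfunction_le_or (hmeas : ∀ x, Measurable (V x))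
    (hindep : iIndepFun V P) (hident : ∀ x, IdentDistrib (V x) (V 0) P P) (hs : 0 < s)
    (hs1 : s ≤ 1) (hatom : ∀ a, P.map (V 0) {t | g * t = a} = 0) (hq0 : 0 ≤ q) (hq : q ≤ 1)
    (hA : ∀ a, ∫⁻ t, ‖(g * t - a)⁻¹‖ₑ ^ s ∂(P.map (V 0)) ≤ ENNReal.ofReal (q / (4 * d + 1)))
    {B : Finset (Zd d)} {x y : Zd d} (hx : x ∈ B) (hy : y ∈ B) {r : ℕ}
    (hr : 2 * r < latticeDist x y) {t K : ℝ} (ht0 : 0 < t) (ht1 : t ≤ 1 / 2)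
    (hK : 0 < K) (hKt : ((4 * d + 1) / K) ^ (r + 1) ≤ t) (hKt' : K ≤ (4 * d + 1) / t)
    (hqt : q ^ r ≤ t ^ 10) :
    P {ω | ¬ ∀ E : ℝ,
      (∀ φ, IsEigenfunction g (fun z => V z ω) B E φ → |φ x| ≤ 3 * (4 * d + 1) * t) ∨
      ∀ φ, IsEigenfunction g (fun z => V z ω) B E φ → |φ y| ≤ 3 * (4 * d + 1) * t} ≤
      ENNReal.ofReal (39 * (4 * d + 1) * (B.card : ℝ) ^ 6 * t ^ s) := by
  set Sx := B.filter fun z => latticeDist x z ≤ r with hSx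
  set Sy := B.filter fun z => latticeDist y z ≤ r with hSy
  have hxS : x ∈ Sx := Finset.mem_filter.2 ⟨hx, by rw [latticeDist_self]; exact Nat.zero_le _⟩
  have hyS : y ∈ Sy := Finset.mem_filter.2 ⟨hy, by rw [latticeDist_self]; exact Nat.zero_le _⟩
  have hdisj : Disjoint Sx Sy := by
    rw [Finset.disjoint_left]
    intro z hzx hzy
    have h1 := (Finset.mem_filter.1 hzx).2
    have h2 := (Finset.mem_filter.1 hzy).2
    have h3 := latticeDist_triangle x z y
    rw [latticeDist_comm z y] at h3
    omega
  set X : Ω → Sx → ℝ := fun ω z => V z ω with hX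
  set Y : Ω → Sy → ℝ := fun ω z => V z ω with hY
  have hXm : Measurable X := measurable_pi_lambda _ fun z => hmeas z
  have hYm : Measurable Y := measurable_pi_lambda _ fun z => hmeas z
  have hXY : IndepFun X Y P := hindep.indepFun_finset Sx Sy hdisj hmeas
  set n : ℝ := (B.card : ℝ) with hn
  have hn1 : 1 ≤ n := Nat.one_le_cast.2 (Finset.card_pos.2 ⟨x, hx⟩)
  have hd : (0 : ℝ) ≤ d := Nat.cast_nonneg d
  set D : ℝ := 4 * d + 1 with hD
  have hD1 : 1 ≤ D := by linarith
  have hSxn : (Sx.card : ℝ) ≤ n := Nat.cast_le.2 (Finset.card_filter_le _ _)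
  have hSyn : (Sy.card : ℝ) ≤ n := Nat.cast_le.2 (Finset.card_filter_le _ _)
  have hts : t ≤ t ^ s := by
    conv_lhs => rw [← Real.rpow_one t]
    exact Real.rpow_le_rpow_of_exponent_ge ht0 (by linarith) hs1
  have hts0 : 0 < t ^ s := Real.rpow_pos_of_pos ht0 s
  have hinv : t⁻¹ ^ s ≤ t⁻¹ := by
    conv_rhs => rw [← Real.rpow_one t⁻¹]
    exact Real.rpow_le_rpow_of_exponent_le ((one_le_inv₀ ht0).2 (by linarith)) hs1
  -- a fixed energy at which the Green function does not decay
  have hedge : ∀ (S : Finset (Zd d)) (z : S) (E : ℝ), (S.card : ℝ) ≤ n →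
      P ((fun ω (z : S) => V z ω) ⁻¹' greenLarge g E S (edgePairs z r) t) ≤
        ENNReal.ofReal (n * t ^ 9) := by
    intro S z E hS
    refine (measure_greenLarge_le hmeas hindep hident hs hs1 hatom hq0 hq hA E S _ ht0
      (M := t ^ 10) fun p hp => ?_).trans (ENNReal.ofReal_le_ofReal ?_)
    · obtain ⟨h1, h2⟩ := Finset.mem_product.1 hp
      rw [Finset.mem_singleton] at h1
      rw [h1]
      exact (pow_le_pow_of_le_one hq0 hq (Finset.mem_filter.1 h2).2).trans hqt
    · have hc : ((edgePairs z r).card : ℝ) ≤ n :=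
        (Nat.cast_le.2 (card_edgePairs_le z r)).trans hS
      calc t⁻¹ ^ s * ((edgePairs z r).card * t ^ 10) ≤ t⁻¹ * (n * t ^ 10) := by gcongr
        _ = n * t ^ 9 := by field_simp
  -- a fixed energy close to the spectrum
  have hwegner : ∀ (S : Finset (Zd d)) (E : ℝ), (S.card : ℝ) ≤ n →
      P ((fun ω (z : S) => V z ω) ⁻¹' greenLarge g E S Finset.univ (1 / t)) ≤
        ENNReal.ofReal (n ^ 2 * t ^ s) := by
    intro S E hS
    refine (measure_greenLarge_le hmeas hindep hident hs hs1 hatom hq0 hq hA E S _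
      (one_div_pos.2 ht0) (M := 1) fun p _ => pow_le_one₀ hq0 hq).trans
      (ENNReal.ofReal_le_ofReal ?_)
    rw [one_div, inv_inv, mul_one, Finset.card_univ, Fintype.card_prod, Fintype.card_coe,
      mul_comm]
    push_cast
    rw [← sq]
    gcongr
  -- At most `5Dn / t^8` grid points lie near the values on `Sx`, each bad for `Sy` with probability
  -- `n t^9`. A power of `t` is left over, which is why the decay is required as `q^r ≤ t^10`.
  have hA1 : P {ω | ∃ i : ℤ, X ω ∈ {w : Sx → ℝ | ∃ z, |i * t ^ 7 - g * w z| ≤ K + 1} ∧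
      Y ω ∈ greenLarge g (i * t ^ 7) Sy (edgePairs ⟨y, hyS⟩ r) t} ≤
      ENNReal.ofReal (n * (5 * D / t ^ 8) * (n * t ^ 9)) := by
    refine measure_exists_int_le (A := fun i : ℤ =>
      {w : Sx → ℝ | ∃ z, |i * t ^ 7 - g * w z| ≤ K + 1}) (B := fun i : ℤ =>
      greenLarge g (i * t ^ 7) Sy (edgePairs ⟨y, hyS⟩ r) t) hXm hXY (fun i => ?_)
      (fun i => measurableSet_greenLarge _ _ _ _ _) (by positivity) (fun w => ?_)
      fun i => hedge Sy _ _ hSyn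
    · rw [Set.ofPred_exists]
      exact MeasurableSet.iUnion fun z => measurableSet_le (by fun_prop) measurable_const
    · obtain ⟨F, hF1, hF2⟩ := exists_finset_int_near Finset.univ (fun z : Sx => g * w z / t ^ 7)
        (r := (K + 1) / t ^ 7) (by positivity)
      refine ⟨F, hF1.trans ?_, fun i hi => hF2 i ?_⟩
      · rw [Finset.card_univ, Fintype.card_coe]
        refine mul_le_mul hSxn ?_ (by positivity) (by positivity)
        rw [le_div_iff₀ (by positivity)]
        have h1 : K * t ≤ D := by rwa [le_div_iff₀ ht0] at hKt'
        have h2 : t ^ 8 ≤ t := by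
          simpa using pow_le_pow_of_le_one ht0.le (by linarith) (show 1 ≤ 8 by norm_num)
        calc (2 * ((K + 1) / t ^ 7) + 1) * t ^ 8 = 2 * (K * t) + 2 * t + t ^ 8 := by
              field_simp
          _ ≤ 5 * D := by linarith
      · obtain ⟨z, hz⟩ := hi
        refine ⟨z, Finset.mem_univ z, ?_⟩
        have : (i : ℝ) - g * w z / t ^ 7 = (i * t ^ 7 - g * w z) / t ^ 7 := by field_simp
        rw [this, abs_div, abs_of_pos (by positivity : 0 < t ^ 7)]
        exact div_le_div_of_nonneg_right hz (by positivity)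
  -- The roles are exchanged: `Sy` selects at most `17n⁴` energies, whatever `t` is, so the weak
  -- bound `n² t^s` for `Sx` suffices.
  have hA2 : P {ω | ∃ k : ℤ,
      Y ω ∈ greenLarge g (k * t ^ 3) Sy Finset.univ (1 / (4 * t ^ 3)) ∧
      X ω ∈ greenLarge g (k * t ^ 3) Sx (edgePairs ⟨x, hxS⟩ r) t ∪
        greenLarge g (k * t ^ 3) Sx Finset.univ (1 / t)} ≤
      ENNReal.ofReal (17 * n ^ 4 * (n * t ^ 9 + n ^ 2 * t ^ s)) := by
    refine measure_exists_int_le (A := fun k : ℤ =>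
      greenLarge g (k * t ^ 3) Sy Finset.univ (1 / (4 * t ^ 3))) (B := fun k : ℤ =>
      greenLarge g (k * t ^ 3) Sx (edgePairs ⟨x, hxS⟩ r) t ∪
        greenLarge g (k * t ^ 3) Sx Finset.univ (1 / t)) hYm hXY.symm
      (fun i => measurableSet_greenLarge _ _ _ _ _)
      (fun i => (measurableSet_greenLarge _ _ _ _ _).union (measurableSet_greenLarge _ _ _ _ _))
      (by positivity) (fun w => ?_) fun k => ?_
    · obtain ⟨F, hF1, hF2⟩ := exists_finset_resonant (isHermitian_boxMatrix g 0 Sy w)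
        (ε := t ^ 3) (by positivity)
      refine ⟨F, hF1.trans ?_, fun k hk => hF2 k ?_⟩
      · rw [Fintype.card_coe]
        gcongr
      · rw [boxMatrix_sub_smul, zero_add, ← sum_univ_abs_eq_entrySum]
        exact hk
    · rw [Set.preimage_union, ENNReal.ofReal_add (by positivity) (by positivity)]
      exact (measure_union_le _ _).trans
        (add_le_add (hedge Sx _ _ hSxn) (hwegner Sx _ hSxn))
  have hmem : ∀ (a : Zd d) (S : Finset (Zd d)), S = B.filter (fun z => latticeDist a z ≤ r) →
      ∀ z ∈ B, latticeDist a z ≤ r → z ∈ S := fun a S hS z hz hzr =>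
    hS ▸ Finset.mem_filter.2 ⟨hz, hzr⟩
  refine (measure_mono fun ω hω => ?_).trans ((measure_union_le _ _).trans
    ((add_le_add hA1 hA2).trans ?_))
  · by_contra hcon
    rw [Set.mem_union, not_or] at hcon
    refine hω fun E => ?_
    exact abs_eigenfunction_le_or (g := g) (v := fun z => V z ω) (Sx := Sx) (Sy := Sy)
      (x := ⟨x, hxS⟩) (y := ⟨y, hyS⟩) (Finset.filter_subset _ _)
      (Finset.filter_subset _ _) (hmem x Sx hSx) (hmem y Sy hSy) ht0 ht1 hK hKt hcon.1 hcon.2 E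
  · rw [← ENNReal.ofReal_add (by positivity) (by positivity)]
    refine ENNReal.ofReal_le_ofReal ?_
    have e1 : n * (5 * D / t ^ 8) * (n * t ^ 9) = 5 * D * (n ^ 2 * t) := by field_simp
    have e2 : n ^ 2 * t ≤ n ^ 6 * t ^ s := by
      gcongr
      norm_num
    have e3 : t ^ 9 ≤ t ^ s := by
      refine le_trans ?_ hts
      simpa using pow_le_pow_of_le_one ht0.le (by linarith) (show 1 ≤ 9 by norm_num)
    have e4 : n ^ 4 * (n * t ^ 9 + n ^ 2 * t ^ s) ≤ 2 * (n ^ 6 * t ^ s) := by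
      have : n ^ 5 * t ^ 9 ≤ n ^ 6 * t ^ s := by
        gcongr
        norm_num
      nlinarith
    have e5 : 0 < n ^ 6 * t ^ s := by positivity
    rw [e1]
    nlinarith

end Probability

end FixedEnergy

/-! ### Length scales -/

section Localization

theorem scale_rpow_le (L₀ k : ℕ) : (scale L₀ k : ℝ) ^ (4 / 3 : ℝ) ≤ scale L₀ (k + 1) := by
  rw [scale]
  push_cast
  exact (Nat.lt_floor_add_one _).le

theorem three_le_scale {L₀ : ℕ} (h : 2 < L₀) (k : ℕ) : 3 ≤ scale L₀ k := by
  induction k with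
  | zero => exact h
  | succ k ih =>
    have h1 : (1 : ℝ) ≤ scale L₀ k := by exact_mod_cast (by omega : 1 ≤ scale L₀ k)
    have h2 : (scale L₀ k : ℝ) ≤ scale L₀ (k + 1) := by
      refine le_trans ?_ (scale_rpow_le L₀ k)
      conv_lhs => rw [← Real.rpow_one (scale L₀ k : ℝ)]
      exact Real.rpow_le_rpow_of_exponent_le h1 (by norm_num)
    exact ih.trans (Nat.cast_le.1 h2)

/-- The logarithm grows by at least `4/3` at each scale, and it starts above `1` because `e < 3`. -/
theorem pow_le_log_scale {L₀ : ℕ} (h : 2 < L₀) (k : ℕ) :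
    (4 / 3 : ℝ) ^ k ≤ Real.log (scale L₀ k) := by
  induction k with
  | zero =>
    rw [pow_zero, Real.le_log_iff_exp_le (by simp [scale]; omega)]
    have : (3 : ℝ) ≤ scale L₀ 0 := by exact_mod_cast three_le_scale h 0
    linarith [Real.exp_one_lt_d9]
  | succ k ih =>
    have h0 : (0 : ℝ) < scale L₀ k := by
      have := three_le_scale h k
      exact_mod_cast (by omega : 0 < scale L₀ k)
    calc (4 / 3 : ℝ) ^ (k + 1) = 4 / 3 * (4 / 3) ^ k := pow_succ' _ _
      _ ≤ 4 / 3 * Real.log (scale L₀ k) := by gcongr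
      _ = Real.log ((scale L₀ k : ℝ) ^ (4 / 3 : ℝ)) := (Real.log_rpow h0 _).symm
      _ ≤ _ := Real.log_le_log (Real.rpow_pos_of_pos h0 _) (scale_rpow_le L₀ k)

theorem sq_log_le_rpow {L : ℝ} (hL : 1 ≤ L) : Real.log L ^ 2 ≤ 6 * L ^ (7 / 8 : ℝ) := by
  have h1 := Real.log_le_rpow_div (by linarith : 0 ≤ L) (by norm_num : (0 : ℝ) < 7 / 16)
  have h2 : (L ^ (7 / 16 : ℝ)) ^ 2 = L ^ (7 / 8 : ℝ) := by
    rw [← Real.rpow_natCast, ← Real.rpow_mul (by linarith)]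
    norm_num
  have h3 : 0 ≤ L ^ (7 / 8 : ℝ) := Real.rpow_nonneg (by linarith) _
  calc Real.log L ^ 2 ≤ (L ^ (7 / 16 : ℝ) / (7 / 16)) ^ 2 :=
        pow_le_pow_left₀ (Real.log_nonneg hL) h1 2
    _ = 256 / 49 * L ^ (7 / 8 : ℝ) := by rw [div_pow, h2]; ring
    _ ≤ _ := by linarith

/-- This reduces to `2^8 < 3^7`. It forces the lattice distances considered to be at least `3`,
hence `r ≥ 1` below. -/
theorem two_lt_rpow {L : ℝ} (hL : 3 ≤ L) : 2 < L ^ (7 / 8 : ℝ) := by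
  refine lt_of_lt_of_le ?_ (Real.rpow_le_rpow (by norm_num) hL (by norm_num))
  refine lt_of_pow_lt_pow_left₀ 8 (by positivity) ?_
  rw [← Real.rpow_natCast (3 ^ (7 / 8 : ℝ)), ← Real.rpow_mul (by norm_num)]
  norm_num

theorem card_ball_le {d : ℕ} (u : Zd d) {L : ℕ} (hL : 3 ≤ L) :
    ((ball u L).card : ℝ) ≤ (L : ℝ) ^ (2 * d) := by
  have h1 : (ball u L).card = (2 * L + 1) ^ d := by
    rw [ball, Pi.card_Icc]
    simp only [Int.card_Icc]
    have : ∀ i, (u i + (L : ℤ) + 1 - (u i - L)).toNat = 2 * L + 1 := fun i => by omega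
    simp [this]
  have h2 : (2 * L + 1) ^ d ≤ (L ^ 2) ^ d := Nat.pow_le_pow_left (by nlinarith) d
  rw [h1, pow_mul]
  exact_mod_cast h2

/-! ### Localization -/

section

variable {d : ℕ} {m g : ℝ} {v : Zd d → ℝ} {u : Zd d} {L : ℕ}

/-- One factor of `|ψ x| |ψ y|` is small and the other is at most `1` by normalization. The factor
`2` comes from treating real and imaginary parts separately. -/
theorem isLocalized_of_forall_pairs {δ : Zd d → Zd d → ℝ}
    (hδ : ∀ x y : Zd d, (L : ℝ) ^ (7 / 8 : ℝ) ≤ latticeDist x y →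
      2 * δ x y ≤ Real.exp (-(gammaExp m L * latticeDist x y)))
    (h : ∀ x ∈ ball u L, ∀ y ∈ ball u L, (L : ℝ) ^ (7 / 8 : ℝ) ≤ latticeDist x y → ∀ E : ℝ,
      (∀ φ, IsEigenfunction g v (ball u L) E φ → |φ x| ≤ δ x y) ∨
      ∀ φ, IsEigenfunction g v (ball u L) E φ → |φ y| ≤ δ x y) :
    IsLocalized m g v u L := by
  intro E ψ hE hψ x y hxy
  rw [norm_sub_eq_latticeDist] at hxy ⊢
  refine le_trans ?_ (hδ x y hxy)
  have hle1 : ∀ z : ball u L, ‖ψ z‖ ≤ 1 := fun z => by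
    refine (sq_le_one_iff₀ (norm_nonneg _)).1 ?_
    rw [← hψ]
    exact Finset.single_le_sum (f := fun x => ‖ψ x‖ ^ 2) (fun _ _ => by positivity)
      (Finset.mem_univ _)
  have key : ∀ z : ball u L,
      (∀ φ, IsEigenfunction g v (ball u L) E.re φ → |φ z| ≤ δ x y) → ‖ψ z‖ ≤ 2 * δ x y := by
    intro z hz
    have h1 := hz _ (isEigenfunction_of_hasEigenvector hE hψ Complex.reLm Complex.abs_re_le_norm)
    have h2 := hz _ (isEigenfunction_of_hasEigenvector hE hψ Complex.imLm Complex.abs_im_le_norm)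
    rw [dif_pos z.2] at h1 h2
    have h3 := Complex.norm_le_abs_re_add_abs_im (ψ z)
    simp only [Complex.reLm_coe, Complex.imLm_coe] at h1 h2
    linarith
  rcases h x x.2 y y.2 hxy E.re with hx | hy
  · exact (mul_le_of_le_one_right (norm_nonneg _) (hle1 y)).trans (key x hx)
  · exact (mul_le_of_le_one_left (norm_nonneg _) (hle1 x)).trans (key y hy)

end

theorem gammaExp_le {m : ℝ} (hm : 0 < m) {L : ℕ} (hL : 1 ≤ L) : gammaExp m L ≤ 2 * m := by
  have : (L : ℝ) ^ (-(1 / 8) : ℝ) ≤ 1 :=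
    Real.rpow_le_one_of_one_le_of_nonpos (by exact_mod_cast hL) (by norm_num)
  rw [gammaExp]
  nlinarith

variable {Ω : Type*} [MeasurableSpace Ω] {P : Measure Ω} [IsProbabilityMeasure P] {d : ℕ}
  {V : Zd d → Ω → ℝ}

/-- A ball is non-localized with stretched-exponentially small probability. -/
theorem measure_not_isLocalized_le (hmeas : ∀ x, Measurable (V x))
    (hindep : iIndepFun V P) (hident : ∀ x, IdentDistrib (V x) (V 0) P P) {g s ν m : ℝ}
    (hs : 0 < s) (hs1 : s ≤ 1) (hatom : ∀ a, P.map (V 0) {t | g * t = a} = 0) (hm : 0 < m)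
    (hν1 : 1 ≤ ν) (hν : 8 * m + Real.log (6 * (4 * d + 1)) ≤ ν)
    (hA : ∀ a, ∫⁻ t, ‖(g * t - a)⁻¹‖ₑ ^ s ∂(P.map (V 0)) ≤
      ENNReal.ofReal (Real.exp (-(10 * ν)) / (4 * d + 1)))
    (u : Zd d) {L : ℕ} (hL : 3 ≤ L) :
    P {ω | ¬ IsLocalized m g (fun x => V x ω) u L} ≤
      ENNReal.ofReal (39 * (4 * d + 1) * (L : ℝ) ^ (16 * d) *
        Real.exp (-(ν * s * (L : ℝ) ^ (7 / 8 : ℝ) / 4))) := by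
  have hd : (0 : ℝ) ≤ d := Nat.cast_nonneg d
  set D : ℝ := 4 * d + 1 with hD
  have hD1 : 1 ≤ D := by linarith
  set B := ball u L with hB
  -- The largest radius with `2r < dist`, so that the two neighbourhoods are disjoint; `dist ≤ 4r`
  -- as soon as `dist ≥ 3`.
  set r : Zd d → Zd d → ℕ := fun x y => (latticeDist x y - 1) / 2 with hr
  set t : Zd d → Zd d → ℝ := fun x y => Real.exp (-(ν * r x y)) with ht
  set bad : Zd d × Zd d → Set Ω := fun p => {ω | ¬ ∀ E : ℝ,
      (∀ φ, IsEigenfunction g (fun z => V z ω) B E φ → |φ p.1| ≤ 3 * D * t p.1 p.2) ∨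
      ∀ φ, IsEigenfunction g (fun z => V z ω) B E φ → |φ p.2| ≤ 3 * D * t p.1 p.2} with hbad
  set pairs := (B ×ˢ B).filter fun p => (L : ℝ) ^ (7 / 8 : ℝ) ≤ latticeDist p.1 p.2 with hpairs
  have hL2 : 2 < (L : ℝ) ^ (7 / 8 : ℝ) := two_lt_rpow (by exact_mod_cast hL)
  have hfar : ∀ x y : Zd d, (L : ℝ) ^ (7 / 8 : ℝ) ≤ latticeDist x y →
      2 * r x y < latticeDist x y ∧ latticeDist x y ≤ 4 * r x y ∧ 1 ≤ r x y := by
    intro x y hxy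
    have : 2 < latticeDist x y := by exact_mod_cast hL2.trans_le hxy
    simp only [hr]
    omega
  have hsub : {ω | ¬ IsLocalized m g (fun x => V x ω) u L} ⊆ ⋃ p ∈ pairs, bad p := by
    intro ω hω
    by_contra hcon
    refine hω (isLocalized_of_forall_pairs (δ := fun x y => 3 * D * t x y) (fun x y hxy => ?_)
      fun x hx y hy hxy => ?_)
    · obtain ⟨-, h2, h3⟩ := hfar x y hxy
      have h3' : (1 : ℝ) ≤ r x y := by exact_mod_cast h3
      have h2' : (latticeDist x y : ℝ) ≤ 4 * r x y := by exact_mod_cast h2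
      have hlog : 0 ≤ Real.log (6 * D) := Real.log_nonneg (by linarith)
      have hγ := gammaExp_le hm (by omega : 1 ≤ L)
      calc 2 * (3 * D * t x y) = Real.exp (Real.log (6 * D)) * t x y := by
            rw [Real.exp_log (by positivity)]
            ring
        _ = Real.exp (Real.log (6 * D) + -(ν * r x y)) := (Real.exp_add _ _).symm
        -- As `γ ≤ 2m` and `dist ≤ 4r`, the required exponent is at most `8mr`. With `r ≥ 1` this is
        -- where `ν ≥ 8m + log(6D)` comes from.
        _ ≤ _ := by
            refine Real.exp_le_exp.2 ?_
            have e1 : gammaExp m L * latticeDist x y ≤ 2 * m * (4 * r x y) := by gcongr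
            nlinarith
    · by_contra hbadp
      refine hcon (Set.mem_biUnion (x := (x, y)) ?_ hbadp)
      exact Finset.mem_filter.2 ⟨Finset.mk_mem_product hx hy, hxy⟩
  have hpair : ∀ p ∈ pairs, P (bad p) ≤ ENNReal.ofReal (39 * D * (B.card : ℝ) ^ 6 *
      Real.exp (-(ν * s * (L : ℝ) ^ (7 / 8 : ℝ) / 4))) := by
    rintro ⟨x, y⟩ hp
    obtain ⟨hxyB, hxy⟩ := Finset.mem_filter.1 hp
    obtain ⟨hx, hy⟩ := Finset.mem_product.1 hxyB
    obtain ⟨h1, h2, h3⟩ := hfar x y hxy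
    have h3' : (1 : ℝ) ≤ r x y := by exact_mod_cast h3
    have h2' : (latticeDist x y : ℝ) ≤ 4 * r x y := by exact_mod_cast h2
    have ht0 : 0 < t x y := Real.exp_pos _
    have htν : t x y ≤ Real.exp (-1) := Real.exp_le_exp.2 (by nlinarith)
    -- With `K = D e^ν` the gain `D / K` is `e^{-ν}`, so `r + 1` steps give at most `t`, while `K ≤
    -- D / t` because `r ≥ 1`. The choice `q = e^{-10ν}` makes `q^r = t^10`.
    refine (measure_not_abs_eigenfunction_le_or hmeas hindep hident hs hs1 hatom
      (Real.exp_pos (-(10 * ν))).le (Real.exp_le_one_iff.2 (by linarith)) hA hx hy h1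
      (t := t x y) (K := D * Real.exp ν) ht0 ?_ (by positivity) ?_ ?_ ?_).trans
      (ENNReal.ofReal_le_ofReal ?_)
    · refine htν.trans ?_
      rw [Real.exp_neg, one_div]
      exact inv_anti₀ two_pos (by linarith [Real.exp_one_gt_d9])
    · have : D / (D * Real.exp ν) = Real.exp (-ν) := by
        rw [Real.exp_neg]
        field_simp
      rw [this, ← Real.exp_nat_mul]
      refine Real.exp_le_exp.2 ?_
      push_cast
      nlinarith
    · rw [le_div_iff₀ ht0, mul_assoc, ht, ← Real.exp_add]
      refine mul_le_of_le_one_right (by positivity) (Real.exp_le_one_iff.2 ?_)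
      nlinarith
    · rw [← Real.exp_nat_mul, ht, ← Real.exp_nat_mul]
      refine Real.exp_le_exp.2 (le_of_eq ?_)
      push_cast
      ring
    · refine mul_le_mul_of_nonneg_left ?_ (by positivity)
      rw [ht, ← Real.exp_mul]
      refine Real.exp_le_exp.2 ?_
      have : ν * s * (L : ℝ) ^ (7 / 8 : ℝ) ≤ ν * s * (4 * r x y) := by
        gcongr
        exact hxy.trans h2'
      linarith
  have hn := card_ball_le u hL
  calc P {ω | ¬ IsLocalized m g (fun x => V x ω) u L} ≤ ∑ p ∈ pairs, P (bad p) :=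
        (measure_mono hsub).trans (measure_biUnion_finset_le _ _)
    _ ≤ ∑ _p ∈ pairs, ENNReal.ofReal (39 * D * (B.card : ℝ) ^ 6 *
          Real.exp (-(ν * s * (L : ℝ) ^ (7 / 8 : ℝ) / 4))) := Finset.sum_le_sum hpair
    _ = ENNReal.ofReal (pairs.card * (39 * D * (B.card : ℝ) ^ 6 *
          Real.exp (-(ν * s * (L : ℝ) ^ (7 / 8 : ℝ) / 4)))) := by
        rw [Finset.sum_const, nsmul_eq_mul, ENNReal.ofReal_mul (Nat.cast_nonneg _),
          ENNReal.ofReal_natCast]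
    _ ≤ _ := by
        refine ENNReal.ofReal_le_ofReal ?_
        have hc : (pairs.card : ℝ) ≤ (B.card : ℝ) ^ 2 := by
          have : pairs.card ≤ B.card ^ 2 := by
            rw [sq, ← Finset.card_product]
            exact Finset.card_filter_le _ _
          exact_mod_cast this
        calc pairs.card * (39 * D * (B.card : ℝ) ^ 6 *
              Real.exp (-(ν * s * (L : ℝ) ^ (7 / 8 : ℝ) / 4)))
            ≤ (B.card : ℝ) ^ 2 * (39 * D * (B.card : ℝ) ^ 6 *
              Real.exp (-(ν * s * (L : ℝ) ^ (7 / 8 : ℝ) / 4))) := by gcongr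
          _ = 39 * D * (B.card : ℝ) ^ 8 *
              Real.exp (-(ν * s * (L : ℝ) ^ (7 / 8 : ℝ) / 4)) := by ring
          _ ≤ 39 * D * ((L : ℝ) ^ (2 * d)) ^ 8 *
              Real.exp (-(ν * s * (L : ℝ) ^ (7 / 8 : ℝ) / 4)) := by gcongr
          _ = _ := by
              rw [← pow_mul]
              congr 3
              ring

end Localization

end Anderson

end

/-! ### Choice of the decay rate and of the disorder threshold -/

theorem mainTheorem1 {Ω : Type*} [MeasurableSpace Ω] (P : Measure Ω) [IsProbabilityMeasure P]
    (d : ℕ) (V : Anderson.Zd d → Ω → ℝ)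
    (hmeas : ∀ x, Measurable (V x))
    (hindep : iIndepFun V P)
    (hident : ∀ x, IdentDistrib (V x) (V 0) P P)
    (hHolder : Anderson.HolderCDF (P.map (V 0)))
    (m : ℝ) (hm : 0 < m) (p : ℝ) (hp : 16 * (d : ℝ) < p) (L₀ : ℕ) (hL₀ : 2 < L₀) :
    ∃ g₀ b : ℝ, 0 < b ∧ ∀ g : ℝ, g₀ ≤ |g| → ∀ (k : ℕ) (u : Anderson.Zd d),
      P.real {ω | ¬ Anderson.IsLocalized m g (fun x => V x ω) u (Anderson.scale L₀ k)} ≤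
        (Anderson.scale L₀ k : ℝ) ^ (-(p * (1 + b) ^ k)) := by
  have hprob : IsProbabilityMeasure (P.map (V 0)) :=
    Measure.isProbabilityMeasure_map (hmeas 0).aemeasurable
  obtain ⟨s, K, hs, hs1, hK, hint⟩ := hHolder.exists_lintegral_inv_rpow_le
  have hd : (0 : ℝ) ≤ d := Nat.cast_nonneg d
  set D : ℝ := 4 * d + 1 with hD
  have hD1 : 1 ≤ D := by linarith
  have hp0 : 0 < p := by linarith
  set c : ℝ := Real.log (39 * D) + 16 * d + p with hc
  -- In `24c / s`, the `24` is `6 · 4`: `6` from `(log L)² ≤ 6 L^{7/8}` and `4` from the rate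
  -- `νs/4`. The constant `c` collects the prefactor, the volume `L^{16d}` and the target exponent.
  obtain ⟨ν, hν1, hν2, hν3⟩ : ∃ ν : ℝ, 1 ≤ ν ∧ 8 * m + Real.log (6 * D) ≤ ν ∧ 24 * c / s ≤ ν :=
    ⟨max 1 (max (8 * m + Real.log (6 * D)) (24 * c / s)), le_max_left _ _,
      (le_max_left _ _).trans (le_max_right _ _), (le_max_right _ _).trans (le_max_right _ _)⟩
  set q := Real.exp (-(10 * ν)) with hq
  have hq0 : 0 < q := Real.exp_pos _
  -- The threshold is where `K / |g|^s` drops to `q / D`; `1 + b = 4/3` is the growth exponent of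
  -- the scales.
  refine ⟨(K * D / q) ^ (1 / s), 1 / 3, by norm_num, fun g hg k u => ?_⟩
  have hg0 : 0 < |g| := lt_of_lt_of_le (Real.rpow_pos_of_pos (by positivity) _) hg
  have hgs : K * D / q ≤ |g| ^ s := by
    have := Real.rpow_le_rpow (Real.rpow_nonneg (by positivity) _) hg hs.le
    rwa [← Real.rpow_mul (by positivity), one_div_mul_cancel hs.ne', Real.rpow_one] at this
  have hA : ∀ a, ∫⁻ t, ‖(g * t - a)⁻¹‖ₑ ^ s ∂(P.map (V 0)) ≤ ENNReal.ofReal (q / D) := by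
    intro a
    refine (Anderson.lintegral_inv_affine_rpow_le hs (abs_pos.1 hg0) hint a).trans
      (ENNReal.ofReal_le_ofReal ?_)
    rw [div_le_div_iff₀ (Real.rpow_pos_of_pos hg0 s) (by positivity)]
    rw [div_le_iff₀ hq0] at hgs
    linarith
  have hatom : ∀ a, P.map (V 0) {t | g * t = a} = 0 := by
    intro a
    refine measure_mono_null (fun t ht => ?_) (hHolder.measure_singleton (a / g))
    exact (eq_div_iff (abs_pos.1 hg0)).2 ((mul_comm _ _).trans ht)
  have hL3 := Anderson.three_le_scale hL₀ k
  have hlogk := Anderson.pow_le_log_scale hL₀ k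
  set L := Anderson.scale L₀ k
  have hL0 : (0 : ℝ) < L := by exact_mod_cast (by omega : 0 < L)
  have hL1 : (1 : ℝ) ≤ L := by exact_mod_cast (by omega : 1 ≤ L)
  refine ENNReal.toReal_le_of_le_ofReal (Real.rpow_nonneg hL0.le _)
    ((Anderson.measure_not_isLocalized_le hmeas hindep hident hs hs1 hatom hm hν1 hν2 hA u
      hL3).trans (ENNReal.ofReal_le_ofReal ?_))
  set l := Real.log L with hl
  have hl1 : 1 ≤ l := (one_le_pow₀ (by norm_num)).trans hlogk
  have hsq := Anderson.sq_log_le_rpow hL1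
  rw [← hl] at hsq
  have hlogD : 0 ≤ Real.log (39 * D) := Real.log_nonneg (by linarith)
  have e1 : (L : ℝ) ^ (16 * d) = Real.exp (16 * d * l) := by
    rw [← Real.rpow_natCast, Real.rpow_def_of_pos hL0, ← hl]
    push_cast
    ring_nf
  rw [e1, Real.rpow_def_of_pos hL0 (-(p * (1 + 1 / 3) ^ k)), ← hl]
  calc 39 * D * Real.exp (16 * d * l) * Real.exp (-(ν * s * (L : ℝ) ^ (7 / 8 : ℝ) / 4))
      = Real.exp (Real.log (39 * D) + 16 * d * l + -(ν * s * (L : ℝ) ^ (7 / 8 : ℝ) / 4)) := by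
        rw [Real.exp_add, Real.exp_add, Real.exp_log (by positivity)]
    _ ≤ _ := by
        refine Real.exp_le_exp.2 ?_
        have hll : l ≤ l ^ 2 := by nlinarith
        have f1 : Real.log (39 * D) ≤ Real.log (39 * D) * l ^ 2 :=
          le_mul_of_one_le_right hlogD (hl1.trans hll)
        have f2 : 16 * d * l ≤ 16 * d * l ^ 2 := by gcongr
        have f3 : l * (p * (1 + 1 / 3) ^ k) ≤ p * l ^ 2 := by
          have : ((1 : ℝ) + 1 / 3) ^ k ≤ l := by
            norm_num
            exact hlogk
          calc l * (p * (1 + 1 / 3) ^ k) ≤ l * (p * l) := by gcongr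
            _ = p * l ^ 2 := by ring
        have f4 : c * l ^ 2 ≤ c * (6 * (L : ℝ) ^ (7 / 8 : ℝ)) :=
          mul_le_mul_of_nonneg_left hsq (by positivity)
        have f5 : 24 * c * (L : ℝ) ^ (7 / 8 : ℝ) ≤ ν * s * (L : ℝ) ^ (7 / 8 : ℝ) := by
          rw [div_le_iff₀ hs] at hν3
          gcongr
        have f6 : c * l ^ 2 = Real.log (39 * D) * l ^ 2 + 16 * d * l ^ 2 + p * l ^ 2 := by
          rw [hc]
          ring
        linarith
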